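/- Let $k\ge 2$ be an even integer and let $q$ be a prime power with $q\equiv k+1 \pmod{2k}$. Let $G_k(q)$ be the digraph with vertex set $\mathbb F_q$ in which $a\to b$ is an edge if and only if $b-a$ is a nonzero $k$-th power in $\mathbb F_q$, and let $\mathcal K_4(G_k(q))$ be the number of transitive subtournaments of order four contained in $G_k(q)$. Extend every character $\chi$ of $\mathbb F_q^*$ (including the trivial one) to $\mathbb F_q$ by $\chi(0)=0$, write $\bar\chi=\chi^{-1}$, and for characters $A,B$ put $$J(A,B)=\sum_{a\in\mathbb F_q}A(a)B(1-a),\qquad \binom{A}{B}=\frac{B(-1)}{q}J(A,\bar B).$$ For characters $A_0,\dots,A_n,B_1,\dots,B_n$ of $\mathbb F_q^*$ and $\lambda\in\mathbb F_q$, let $${}_{n+1}F_n\left(\begin{matrix}A_0,&A_1,&\dots,&A_n\\&B_1,&\dots,&B_n\end{matrix}\,\Big|\,\lambda\right)_q=\frac{q}{q-1}\sum_\chi\binom{A_0\chi}{\chi}\binom{A_1\chi}{B_1\chi}\cdots\binom{A_n\chi}{B_n\chi}\chi(\lambda),$$ the sum being over all characters $\chi$ of $\mathbb F_q^*$. Let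 $\chi_k$ be any character of $\mathbb F_q^*$ of order $k$, and for $\vec t=(t_1,\dots,t_5)\in(\mathbb Z/k\mathbb Z)^5$ let $${}_3F_2(\vec t\,|\,\lambda)_{q,k}=(-1)^{t_3+t_5}\,{}_3F_2\left(\begin{matrix}\chi_k^{t_1},&\chi_k^{t_2},&\chi_k^{t_3}\\&\chi_k^{t_4},&\chi_k^{t_5}\end{matrix}\,\Big|\,\lambda\right)_q .$$ Define $$\mathbb R_k(q)=\sum_{\substack{1\le s,t\le k-1\\ s+t\not\equiv0\,(k)}}J(\chi_k^s,\chi_k^t),\qquad \mathbb S_k(q)=\sum_{\substack{1\le s,t,v\le k-1\\ s+t,\,v+t,\,v-s\not\equiv0\,(k)}}J(\chi_k^s,\chi_k^t)\,J(\bar\chi_k^{\,s},\chi_k^v),$$ $$\mathbb S^-_k(q)=\sum_{\substack{1\le s,t,v\le k-1\\ s+t,\,v+t,\,v-s\not\equiv0\,(k)}}(-1)^{s+t}J(\chi_k^s,\chi_k^t)\,J(\bar\chi_k^{\,s},\chi_k^v),$$ and let $X_k$ be the set of all $(t_1,\dots,t_5)\in(\mathbb Z/k\mathbb Z)^5$ such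 that none of $t_1,t_2,t_3$ lies in $\{0,t_4,t_5\}$ and $t_1+t_2+t_3\ne t_4+t_5$. Then $$\mathcal K_4(G_k(q))=\frac{q(q-1)}{k^6}\Bigl[10\,\mathbb R_k(q)^2+5(q-k^2+1)\,\mathbb R_k(q)-10\,\mathbb S_k(q)-5\,\mathbb S^-_k(q)+q^2-10(k-1)^2q+5k^2(k-1)+1+q^2\sum_{\vec t\in X_k}{}_3F_2(\vec t\,|\,1)_{q,k}\Bigr].$$ -/

import Mathlib

/-- `IsTransitiveSubtournament G S T` : the digraph with vertex set `S` and arcs `T` is a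
subdigraph of `G` and is a transitive tournament. -/
structure IsTransitiveSubtournament {V : Type*} (G : Digraph V) (S : Finset V)
    (T : Digraph V) : Prop where
  /-- every arc of `T` is an arc of `G` joining two vertices in `S` -/
  sub : ∀ a b, T.Adj a b → a ∈ S ∧ b ∈ S ∧ G.Adj a b
  /-- there are no loops -/
  irrefl : ∀ a, ¬ T.Adj a a
  /-- between two distinct vertices there is exactly one arc -/
  tournament : ∀ a ∈ S, ∀ b ∈ S, a ≠ b → Xor (T.Adj a b) (T.Adj b a)
  /-- the arc relation is transitive -/
  trans : ∀ a b c, T.Adj a b → T.Adj b c → T.Adj a c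

/-- The number of transitive subtournaments of order `m` contained in the digraph `G`. -/
noncomputable def numTransitiveSubtournaments {V : Type*} (m : ℕ) (G : Digraph V) : ℕ :=
  {P : Finset V × Digraph V | P.1.card = m ∧ IsTransitiveSubtournament G P.1 P.2}.ncard

/-- The subgroup of `k`-th power residues in the multiplicative group of `F`. -/
def powerResidues (F : Type*) [Field F] (k : ℕ) : Subgroup Fˣ :=
  (powMonoidHom k : Fˣ →* Fˣ).range

/-- The `k`-th power Paley digraph on `F`: `a → b` iff `b - a` is a `k`-th power residue. -/
def paleyDigraph (F : Type*) [Field F] (k : ℕ) : Digraph F where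
  Adj a b := ∃ u ∈ powerResidues F k, (u : F) = b - a

section Characters

variable {F : Type*} [Field F] [Fintype F]

noncomputable instance instFintypeComplexMulChar : Fintype (MulChar F ℂ) :=
  Fintype.ofFinite _

/-- Greene's symbol `(A over B) = (B(-1) / q) * J(A, B⁻¹)`. A multiplicative character
of `F`, including the trivial one, takes the value `0` at `0`. -/
noncomputable def greeneBinom (A B : MulChar F ℂ) : ℂ :=
  B (-1) / (Fintype.card F : ℂ) * jacobiSum A B⁻¹

/-- Greene's finite field hypergeometric function `ₙ₊₁Fₙ` with upper parameters
`A₀, A 0, …, A (n-1)`, lower parameters `B 0, …, B (n-1)`, and argument `x`. -/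
noncomputable def greeneHyp {n : ℕ} (A₀ : MulChar F ℂ) (A B : Fin n → MulChar F ℂ)
    (x : F) : ℂ :=
  (Fintype.card F : ℂ) / ((Fintype.card F : ℂ) - 1) *
    ∑ χ : MulChar F ℂ,
      greeneBinom (A₀ * χ) χ * (∏ i, greeneBinom (A i * χ) (B i * χ)) * χ x

/-- The function `₃F₂(t | x)` attached to a character `χ` of even order `k` and
`t = (t₁, …, t₅) ∈ (ℤ/kℤ)⁵` (with `tᵢ` written `t (i - 1)`):
`(-1)^(t₃+t₅) ₃F₂(χ^t₁, χ^t₂, χ^t₃; χ^t₄, χ^t₅ | x)`. -/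
noncomputable def hypVec {k : ℕ} (χ : MulChar F ℂ) (t : Fin 5 → ZMod k) (x : F) : ℂ :=
  (-1) ^ ((t 2).val + (t 4).val) *
    greeneHyp (χ ^ (t 0).val) ![χ ^ (t 1).val, χ ^ (t 2).val]
      ![χ ^ (t 3).val, χ ^ (t 4).val] x

/-- The sum `ℝ_k(q)` of Jacobi sums `J(χ^s, χ^t)`. -/
noncomputable def jacR (k : ℕ) (χ : MulChar F ℂ) : ℂ :=
  ∑ s ∈ Finset.Icc 1 (k - 1), ∑ t ∈ Finset.Icc 1 (k - 1),
    if ¬ (k : ℤ) ∣ (s : ℤ) + t then jacobiSum (χ ^ s) (χ ^ t) else 0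

/-- The sum `𝕊_k(q)` of products `J(χ^s, χ^t) J(χ^(-s), χ^v)`. -/
noncomputable def jacS (k : ℕ) (χ : MulChar F ℂ) : ℂ :=
  ∑ s ∈ Finset.Icc 1 (k - 1), ∑ t ∈ Finset.Icc 1 (k - 1), ∑ v ∈ Finset.Icc 1 (k - 1),
    if ¬ (k : ℤ) ∣ (s : ℤ) + t ∧ ¬ (k : ℤ) ∣ (v : ℤ) + t ∧ ¬ (k : ℤ) ∣ (v : ℤ) - s then
      jacobiSum (χ ^ s) (χ ^ t) * jacobiSum (χ⁻¹ ^ s) (χ ^ v) else 0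

/-- The sum `𝕊⁻_k(q)`: as `jacS`, with the sign `(-1)^(s+t)`. -/
noncomputable def jacSMinus (k : ℕ) (χ : MulChar F ℂ) : ℂ :=
  ∑ s ∈ Finset.Icc 1 (k - 1), ∑ t ∈ Finset.Icc 1 (k - 1), ∑ v ∈ Finset.Icc 1 (k - 1),
    if ¬ (k : ℤ) ∣ (s : ℤ) + t ∧ ¬ (k : ℤ) ∣ (v : ℤ) + t ∧ ¬ (k : ℤ) ∣ (v : ℤ) - s then
      (-1) ^ (s + t) * jacobiSum (χ ^ s) (χ ^ t) * jacobiSum (χ⁻¹ ^ s) (χ ^ v) else 0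

end Characters

/-- The set `X_k` of vectors `(t₁, …, t₅) ∈ (ℤ/kℤ)⁵` such that each of `t₁, t₂, t₃` differs
from each of `0, t₄, t₅`, and `t₁ + t₂ + t₃ ≠ t₄ + t₅`. -/
def nondegenerate (k : ℕ) [NeZero k] : Finset (Fin 5 → ZMod k) :=
  {t | (t 0 ≠ 0 ∧ t 0 ≠ t 3 ∧ t 0 ≠ t 4) ∧
       (t 1 ≠ 0 ∧ t 1 ≠ t 3 ∧ t 1 ≠ t 4) ∧
       (t 2 ≠ 0 ∧ t 2 ≠ t 3 ∧ t 2 ≠ t 4) ∧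
       t 0 + t 1 + t 2 ≠ t 3 + t 4}

/-! The congruence on q forces χ(-1) = -1 (`apply_neg_one`), so the digraph is asymmetric and a
transitive subtournament is the same as an increasing 4-tuple of vertices. Translating the first
vertex to 0 and dividing by the second, which is then a residue, gives the count q · (q-1)/k · N,
where N sums over y, z the product of the residue indicators of y, z, y-1, z-1, y-z. Each indicator
is the mean of the k powers of χ, so k^5 N is the sum of `pentagonSum` over (ℤ/k)^5.

The five exponents are weights on five of the ten edges of the complete graph on the points ∞, 0, 1,
z, y of the projective line. Requiring zero sum at each vertex determines the other five weights,
and makes the sum invariant under Möbius renormalisation after cyclically relabelling the points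
(`pentagonSum_rotate`). Under this rotation the edges form two orbits: the sides and the diagonals
of a pentagon.

The weights with all ten entries nonzero correspond exactly to X_k, and there the pentagon sum is q²
times the ₃F₂ value (`sq_mul_hypVec`, `sq_mul_sum_hypVec`). Otherwise a vanishing edge can be
rotated to one where the double sum collapses to a product of two Jacobi sums minus a third
(`pentagonSum_side`, `pentagonSum_diagonal`). In terms of Gauss sums these values fit a single
rotation-invariant expression, `degenerateValue`, an inclusion-exclusion over patterns of zero edges
which vanishes on nondegenerate weights. It can therefore be summed over all weights without
casework, as five times the total of one rotation class of terms (`sum_degenerateTerm`). Single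
edges yield ℝ² and ℝ, pairs of disjoint edges yield 𝕊 and 𝕊⁻, and larger patterns give the
lower-order corrections. -/

/-! ### Formal Gauss sums and the closed form on degenerate weights -/

/-- A sign character `ε` of `ℤ/k` together with numbers `g` that multiply like Gauss sums. -/
structure GaussSystem {k : ℕ} (q : ℂ) (ε g : ZMod k → ℂ) : Prop where
  q_ne_zero : q ≠ 0
  eps_add : ∀ x y, ε (x + y) = ε x * ε y
  eps_sq : ∀ x, ε x ^ 2 = 1
  g_mul_g_neg : ∀ x, x ≠ 0 → g x * g (-x) = ε x * q

namespace GaussSystem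

variable {k : ℕ} {q : ℂ} {ε g : ZMod k → ℂ}

lemma eps_zero (h : GaussSystem q ε g) : ε 0 = 1 := by
  have h1 := h.eps_add 0 0
  have h2 := h.eps_sq 0
  rw [add_zero] at h1
  rw [h1, ← sq, h2]

lemma eps_neg (h : GaussSystem q ε g) (x : ZMod k) : ε (-x) = ε x := by
  have h1 := h.eps_add x (-x)
  have h2 := h.eps_sq x
  rw [add_neg_cancel, h.eps_zero] at h1
  linear_combination (-ε (-x)) * h2 - ε x * h1

end GaussSystem

/-- The symmetric form of a nondegenerate Jacobi sum: `g x * g y * g z / q` when `x, y, z ≠ 0`. -/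
noncomputable def triple {k : ℕ} (q : ℂ) (g : ZMod k → ℂ) (x y z : ZMod k) : ℂ :=
  if x = 0 ∨ y = 0 ∨ z = 0 then 0 else g x * g y * g z / q

/-- The symmetric form of a Jacobi sum, including its degenerate values. -/
noncomputable def fullTriple {k : ℕ} (q : ℂ) (ε g : ZMod k → ℂ) (x y z : ZMod k) : ℂ :=
  triple q g x y z - (if x = 0 then ε y else 0) - (if y = 0 then ε z else 0)
    - (if z = 0 then ε x else 0) + (if x = 0 ∧ y = 0 ∧ z = 0 then q + 1 else 0)

/-- The part of `degenerateValue` indexed by a single rotation of the pentagon. Here `a i` is the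
weight of the side `{i, i + 1}` and `b i` is the weight of the diagonal `{i, i + 2}`. -/
noncomputable def degenerateTerm {k : ℕ} (q : ℂ) (ε g : ZMod k → ℂ)
    (a0 a1 a2 a3 a4 b0 b1 b2 b3 b4 : ZMod k) : ℂ :=
  (if a3 = 0 then ε (b4 + b1) * (triple q g b4 b2 a4 * triple q g b1 a2 b3 - triple q g a0 a1 b0)
    else 0)
  + (if b4 = 0 then ε (b1 + b2) * (triple q g b2 a3 a4 * triple q g b1 a0 a1 - triple q g b0 a2 b3)
    else 0)
  -- The next three summands are the rotation classes of pairs of disjoint edges. Both edges of a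
  -- pair contribute the same product of two `triple`s, so one copy is removed.
  + (if a0 = 0 ∧ a2 = 0 then
      1 - if a3 = 0 then 0 else ε (b1 + b3) * triple q g b1 b4 a1 * triple q g b3 a4 b0 else 0)
  + (if a2 = 0 ∧ b4 = 0 then
      ε a4 - if b0 = 0 then 0 else ε (b1 + b2) * triple q g b2 a3 a4 * triple q g b1 a0 a1 else 0)
  + (if b4 = 0 ∧ b0 = 0 then ε (b1 + b2 + a2) -
      if a2 = 0 then 0 else ε (b1 + b2) * triple q g b2 a3 a4 * triple q g b1 a0 a1 else 0)
  -- An edge with the triangle on the other three vertices (two rotation classes), then the star of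
  -- a vertex.
  - (if a2 = 0 ∧ a4 = 0 ∧ a0 = 0 ∧ b4 = 0 then q + 1 else 0)
  - (if b4 = 0 ∧ b0 = 0 ∧ a2 = 0 ∧ b3 = 0 then (q + 1) * ε a4 else 0)
  + (if a3 = 0 ∧ a4 = 0 ∧ b4 = 0 ∧ b2 = 0 then
      (q + 1) * ε b0 * triple q g a0 a1 b0 + (if a0 = 0 ∧ a2 = 0 then q else 0)
        + (if b3 = 0 ∧ a1 = 0 then q else 0) + (if b0 = 0 ∧ b1 = 0 then q * ε a0 else 0) else 0)
  -- The zero weight is fixed by rotation. The constant makes its five copies total (q-2)(q-3), the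
  -- number of pairs y ≠ z avoiding 0 and 1.
  + (if a0 = 0 ∧ a1 = 0 ∧ a2 = 0 ∧ a3 = 0 ∧ a4 = 0 ∧ b0 = 0 ∧ b1 = 0 ∧ b2 = 0 ∧ b3 = 0 ∧ b4 = 0
      then (q ^ 2 - 10 * q + 1) / 5 else 0)

/-- A closed form, in terms of Gauss sums, for the pentagon sums with a vanishing edge weight. -/
noncomputable def degenerateValue {k : ℕ} (q : ℂ) (ε g : ZMod k → ℂ)
    (a0 a1 a2 a3 a4 b0 b1 b2 b3 b4 : ZMod k) : ℂ :=
  degenerateTerm q ε g a0 a1 a2 a3 a4 b0 b1 b2 b3 b4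
  + degenerateTerm q ε g a1 a2 a3 a4 a0 b1 b2 b3 b4 b0
  + degenerateTerm q ε g a2 a3 a4 a0 a1 b2 b3 b4 b0 b1
  + degenerateTerm q ε g a3 a4 a0 a1 a2 b3 b4 b0 b1 b2
  + degenerateTerm q ε g a4 a0 a1 a2 a3 b4 b0 b1 b2 b3

/-! ### The closed form agrees with the Jacobi-sum expressions -/

section DegenerateValue

set_option linter.unusedSimpArgs false
variable {k : ℕ} {q : ℂ} {ε g : ZMod k → ℂ}

lemma GaussSystem.g_mul_g (h : GaussSystem q ε g) {x y : ZMod k} (hxy : x + y = 0) (hx : x ≠ 0) :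
    g x * g y = ε x * q := by
  rw [← h.g_mul_g_neg x hx, eq_neg_of_add_eq_zero_right hxy]

/-- Three weights with zero sum cannot have exactly two zeros, so five patterns remain. The trailing
equations record how each one simplifies `p`, `r`, `s`. -/
lemma zero_patterns {x y z x' y' z' p r s : ZMod k} (hz : x + y + z = 0)
    (hp : p = x + x') (hr : r = y + y') (hs : s = z + z') :
    (x ≠ 0 ∧ y ≠ 0 ∧ z ≠ 0 ∧ True) ∨ (x = 0 ∧ y ≠ 0 ∧ z ≠ 0 ∧ p = x') ∨
    (x ≠ 0 ∧ y = 0 ∧ z ≠ 0 ∧ r = y') ∨ (x ≠ 0 ∧ y ≠ 0 ∧ z = 0 ∧ s = z') ∨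
    (x = 0 ∧ y = 0 ∧ z = 0 ∧ p = x' ∧ r = y' ∧ s = z') := by
  by_cases x = 0 <;> by_cases y = 0 <;> by_cases z = 0 <;> simp_all

set_option maxHeartbeats 4000000 in
/-- Expansion of a degenerate pentagon sum along a vanishing diagonal. -/
lemma degenerateValue_of_diagonal (h : GaussSystem q ε g) {x y z x' y' z' p r s : ZMod k}
    (hz : x + y + z = 0) (hz' : x' + y' + z' = 0) (hp : p = x + x') (hr : r = y + y')
    (hs : s = z + z') :
    ε (y' + x) * (fullTriple q ε g x y z * fullTriple q ε g y' z' x' - fullTriple q ε g r s p) =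
      degenerateValue q ε g z' x' s y z r y' x p 0 := by
  have prs : p + r + s = 0 := by rw [hp, hr, hs]; linear_combination hz + hz'
  -- `x, y, z` and `x', y', z'` join the two ends of the vanishing edge to the other three vertices,
  -- and `p, r, s` are the sides of the triangle on those. A zero in a zero-sum triple makes the
  -- other two weights opposite, so their Gauss sums multiply to a sign times q.
  have g1 : x = 0 → y ≠ 0 → g y * g z = ε y * q := fun h0 ↦ h.g_mul_g (by grind)
  have g2 : y = 0 → x ≠ 0 → g x * g z = ε x * q := fun h0 ↦ h.g_mul_g (by grind)
  have g3 : z = 0 → x ≠ 0 → g x * g y = ε x * q := fun h0 ↦ h.g_mul_g (by grind)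
  have g4 : x' = 0 → y' ≠ 0 → g y' * g z' = ε y' * q := fun h0 ↦ h.g_mul_g (by grind)
  have g5 : y' = 0 → x' ≠ 0 → g x' * g z' = ε x' * q := fun h0 ↦ h.g_mul_g (by grind)
  have g6 : z' = 0 → x' ≠ 0 → g x' * g y' = ε x' * q := fun h0 ↦ h.g_mul_g (by grind)
  have g7 : p = 0 → r ≠ 0 → g r * g s = ε r * q := fun h0 ↦ h.g_mul_g (by grind)
  have g8 : r = 0 → p ≠ 0 → g p * g s = ε p * q := fun h0 ↦ h.g_mul_g (by grind)
  have g9 : s = 0 → p ≠ 0 → g p * g r = ε p * q := fun h0 ↦ h.g_mul_g (by grind)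
  have g10 : p = 0 → x ≠ 0 → g x * g x' = ε x * q := fun h0 ↦ h.g_mul_g (by grind)
  have g11 : r = 0 → y ≠ 0 → g y * g y' = ε y * q := fun h0 ↦ h.g_mul_g (by grind)
  have g12 : s = 0 → z ≠ 0 → g z * g z' = ε z * q := fun h0 ↦ h.g_mul_g (by grind)
  have ez : ε z = ε x * ε y := by
    rw [← h.eps_add, ← h.eps_neg, eq_neg_of_add_eq_zero_left hz]
  have ez' : ε z' = ε x' * ε y' := by
    rw [← h.eps_add, ← h.eps_neg, eq_neg_of_add_eq_zero_left hz']
  have ep : ε p = ε x * ε x' := by rw [hp, h.eps_add]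
  have er : ε r = ε y * ε y' := by rw [hr, h.eps_add]
  have es : ε s = ε x * ε y * (ε x' * ε y') := by rw [hs, h.eps_add, ez, ez']
  have sx := h.eps_sq x
  have sy := h.eps_sq y
  have sx' := h.eps_sq x'
  have sy' := h.eps_sq y'
  have e0 := h.eps_zero
  have hq := h.q_ne_zero
  rcases zero_patterns hz hp hr hs with ⟨x0, y0, z0, hpx⟩ | ⟨x0, y0, z0, hpx⟩ |
    ⟨x0, y0, z0, hpx⟩ | ⟨x0, y0, z0, hpx⟩ | ⟨x0, y0, z0, hpx⟩ <;>
  rcases zero_patterns hz' (hp.trans (add_comm _ _)) (hr.trans (add_comm _ _))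
    (hs.trans (add_comm _ _)) with ⟨x0', y0', z0', hpx'⟩ | ⟨x0', y0', z0', hpx'⟩ |
    ⟨x0', y0', z0', hpx'⟩ | ⟨x0', y0', z0', hpx'⟩ | ⟨x0', y0', z0', hpx'⟩ <;>
  by_cases p0 : p = 0 <;> by_cases r0 : r = 0 <;> by_cases s0 : s = 0 <;>
  -- Incompatible zero patterns are refuted in `ZMod k`. In the others every condition is decided
  -- and an algebraic identity in the values of `ε` and `g` is left.
  first
  | (exfalso; clear h ez ez' ep er es sx sy sx' sy' e0 g1 g2 g3 g4 g5 g6 g7 g8 g9 g10 g11 g12; grind)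
  | (simp only [degenerateValue, degenerateTerm, fullTriple, triple, hpx, hpx', x0, y0, z0, x0', y0',
       z0', p0, r0, s0, if_true, if_false, and_self, or_self, true_and, and_true, false_and,
       and_false, true_or, or_true, false_or, or_false, mul_zero, zero_mul, sub_zero, zero_sub,
       add_zero, zero_add, h.eps_add, e0] <;>
     grind)

set_option maxHeartbeats 4000000 in
/-- Expansion of a degenerate pentagon sum along a vanishing side. -/
lemma degenerateValue_of_side (h : GaussSystem q ε g) {x y z x' y' z' p r s : ZMod k}
    (hz : x + y + z = 0) (hz' : x' + y' + z' = 0) (hp : p = x + x') (hr : r = y + y')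
    (hs : s = z + z') :
    ε (z + z') * (fullTriple q ε g z x y * fullTriple q ε g z' x' y' - fullTriple q ε g p r s) =
      degenerateValue q ε g p r x' 0 y s z' x y' z := by
  have prs : p + r + s = 0 := by rw [hp, hr, hs]; linear_combination hz + hz'
  have g1 : x = 0 → y ≠ 0 → g y * g z = ε y * q := fun h0 ↦ h.g_mul_g (by grind)
  have g2 : y = 0 → x ≠ 0 → g x * g z = ε x * q := fun h0 ↦ h.g_mul_g (by grind)
  have g3 : z = 0 → x ≠ 0 → g x * g y = ε x * q := fun h0 ↦ h.g_mul_g (by grind)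
  have g4 : x' = 0 → y' ≠ 0 → g y' * g z' = ε y' * q := fun h0 ↦ h.g_mul_g (by grind)
  have g5 : y' = 0 → x' ≠ 0 → g x' * g z' = ε x' * q := fun h0 ↦ h.g_mul_g (by grind)
  have g6 : z' = 0 → x' ≠ 0 → g x' * g y' = ε x' * q := fun h0 ↦ h.g_mul_g (by grind)
  have g7 : p = 0 → r ≠ 0 → g r * g s = ε r * q := fun h0 ↦ h.g_mul_g (by grind)
  have g8 : r = 0 → p ≠ 0 → g p * g s = ε p * q := fun h0 ↦ h.g_mul_g (by grind)
  have g9 : s = 0 → p ≠ 0 → g p * g r = ε p * q := fun h0 ↦ h.g_mul_g (by grind)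
  have g10 : p = 0 → x ≠ 0 → g x * g x' = ε x * q := fun h0 ↦ h.g_mul_g (by grind)
  have g11 : r = 0 → y ≠ 0 → g y * g y' = ε y * q := fun h0 ↦ h.g_mul_g (by grind)
  have g12 : s = 0 → z ≠ 0 → g z * g z' = ε z * q := fun h0 ↦ h.g_mul_g (by grind)
  have ez : ε z = ε x * ε y := by
    rw [← h.eps_add, ← h.eps_neg, eq_neg_of_add_eq_zero_left hz]
  have ez' : ε z' = ε x' * ε y' := by
    rw [← h.eps_add, ← h.eps_neg, eq_neg_of_add_eq_zero_left hz']
  have ep : ε p = ε x * ε x' := by rw [hp, h.eps_add]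
  have er : ε r = ε y * ε y' := by rw [hr, h.eps_add]
  have es : ε s = ε x * ε y * (ε x' * ε y') := by rw [hs, h.eps_add, ez, ez']
  have sx := h.eps_sq x
  have sy := h.eps_sq y
  have sx' := h.eps_sq x'
  have sy' := h.eps_sq y'
  have e0 := h.eps_zero
  have hq := h.q_ne_zero
  rcases zero_patterns hz hp hr hs with ⟨x0, y0, z0, hpx⟩ | ⟨x0, y0, z0, hpx⟩ |
    ⟨x0, y0, z0, hpx⟩ | ⟨x0, y0, z0, hpx⟩ | ⟨x0, y0, z0, hpx⟩ <;>
  rcases zero_patterns hz' (hp.trans (add_comm _ _)) (hr.trans (add_comm _ _))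
    (hs.trans (add_comm _ _)) with ⟨x0', y0', z0', hpx'⟩ | ⟨x0', y0', z0', hpx'⟩ |
    ⟨x0', y0', z0', hpx'⟩ | ⟨x0', y0', z0', hpx'⟩ | ⟨x0', y0', z0', hpx'⟩ <;>
  by_cases p0 : p = 0 <;> by_cases r0 : r = 0 <;> by_cases s0 : s = 0 <;>
  first
  | (exfalso; clear h ez ez' ep er es sx sy sx' sy' e0 g1 g2 g3 g4 g5 g6 g7 g8 g9 g10 g11 g12; grind)
  | (simp only [degenerateValue, degenerateTerm, fullTriple, triple, hpx, hpx', x0, y0, z0, x0', y0',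
       z0', p0, r0, s0, if_true, if_false, and_self, or_self, true_and, and_true, false_and,
       and_false, true_or, or_true, false_or, or_false, mul_zero, zero_mul, sub_zero, zero_sub,
       add_zero, zero_add, h.eps_add, e0] <;>
     grind)

end DegenerateValue

/-! ### Rotation of the pentagon, and the sum over a vanishing side -/

section Pentagon

variable {k : ℕ} {q : ℂ} {ε g : ZMod k → ℂ}

lemma triple_swap (x y z : ZMod k) : triple q g x y z = triple q g y x z := by
  simp only [triple, or_left_comm, mul_comm (g x)]

lemma triple_swap_right (x y z : ZMod k) : triple q g x y z = triple q g x z y := by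
  simp only [triple, or_comm (a := y = 0), mul_right_comm]

/-- Weights on the edges of a pentagon with zero sum at each vertex, in free coordinates. -/
abbrev PentagonWeight (k : ℕ) : Type := ZMod k × ZMod k × ZMod k × ZMod k × ZMod k

/-- Apply a function to the five side weights and the five diagonal weights of a pentagon. -/
def onEdges (f : ZMod k → ZMod k → ZMod k → ZMod k → ZMod k → ZMod k → ZMod k → ZMod k → ZMod k →
    ZMod k → ℂ) : PentagonWeight k → ℂ
  | (a, b, c, d, e) => f (c + d + e) (-(a + b + c + d + e)) d e (-(a + c + e)) (a + b + e) b c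
      (-(b + d + e)) a

/-- Rotation of a weighted pentagon. -/
def pentagonRotate (k : ℕ) : PentagonWeight k ≃ PentagonWeight k where
  toFun | (a, b, c, d, e) => (a + b + e, c, -(b + d + e), e, -(a + c + e))
  invFun | (a, b, c, d, e) => (-(b + d + e), a + b + e, b, -(a + b + c + d + e), d)
  left_inv := by rintro ⟨a, b, c, d, e⟩; ext <;> simp <;> ring
  right_inv := by rintro ⟨a, b, c, d, e⟩; ext <;> simp <;> ring

lemma onEdges_rotate (f : ZMod k → ZMod k → ZMod k → ZMod k → ZMod k → ZMod k → ZMod k → ZMod k →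
    ZMod k → ZMod k → ℂ) (t : PentagonWeight k) :
    onEdges f (pentagonRotate k t) =
      onEdges (fun a0 a1 a2 a3 a4 b0 b1 b2 b3 b4 ↦ f a1 a2 a3 a4 a0 b1 b2 b3 b4 b0) t := by
  obtain ⟨a, b, c, d, e⟩ := t
  simp only [onEdges, pentagonRotate, Equiv.coe_fn_mk]
  congr 1 <;> ring

lemma onEdges_degenerateValue_rotate (t : PentagonWeight k) :
    onEdges (degenerateValue q ε g) (pentagonRotate k t) = onEdges (degenerateValue q ε g) t := by
  rw [onEdges_rotate]
  obtain ⟨a, b, c, d, e⟩ := t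
  simp only [onEdges, degenerateValue]
  ring

variable [NeZero k]

/-- Rotation permutes the weights, so the five rotated copies of the term have equal totals. -/
lemma sum_onEdges_degenerateValue :
    ∑ t, onEdges (degenerateValue q ε g) t = 5 * ∑ t, onEdges (degenerateTerm q ε g) t := by
  have key : ∀ t, onEdges (degenerateValue q ε g) t =
      onEdges (degenerateTerm q ε g) t +
      onEdges (degenerateTerm q ε g) (pentagonRotate k t) +
      onEdges (degenerateTerm q ε g) (pentagonRotate k (pentagonRotate k t)) +
      onEdges (degenerateTerm q ε g) (pentagonRotate k (pentagonRotate k (pentagonRotate k t))) +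
      onEdges (degenerateTerm q ε g) (pentagonRotate k (pentagonRotate k (pentagonRotate k
        (pentagonRotate k t)))) := by
    rintro ⟨a, b, c, d, e⟩
    simp only [onEdges_rotate]
    rfl
  have hs := fun f : PentagonWeight k → ℂ ↦ Equiv.sum_comp (pentagonRotate k) f
  simp_rw [key, Finset.sum_add_distrib]
  rw [hs (fun t ↦ onEdges (degenerateTerm q ε g) (pentagonRotate k (pentagonRotate k
      (pentagonRotate k t)))),
    hs (fun t ↦ onEdges (degenerateTerm q ε g) (pentagonRotate k (pentagonRotate k t))),
    hs (fun t ↦ onEdges (degenerateTerm q ε g) (pentagonRotate k t)), hs]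
  ring

lemma sum_shift (c : ZMod k) (f : ZMod k → ℂ) : ∑ x, f x = ∑ x, f (x + c) :=
  (Equiv.sum_comp (Equiv.addRight c) f).symm

lemma sum_reflect (c : ZMod k) (f : ZMod k → ℂ) : ∑ x, f x = ∑ x, f (c - x) :=
  (Equiv.sum_comp (Equiv.subLeft c) f).symm

/-- The sum over all nondegenerate Jacobi sums, in symmetric form. -/
noncomputable def tripleSum (k : ℕ) [NeZero k] (q : ℂ) (ε g : ZMod k → ℂ) : ℂ :=
  ∑ s, ∑ t, ε s * triple q g s t (-(s + t))

/-- The product of two Jacobi sums with opposite first entries, in symmetric form. -/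
noncomputable def triplePair (q : ℂ) (g : ZMod k → ℂ) (s t v : ZMod k) : ℂ :=
  if v + t = 0 then 0 else triple q g s t (-(s + t)) * triple q g (-s) v (s - v)

/-- The product separates into the variables (a, c) and (b, d). The subtracted triangle term, after
a shift of `d`, depends only on a + b and `d`, and so is counted k² times. -/
lemma sum_side (h : GaussSystem q ε g) :
    ∑ a : ZMod k, ∑ b, ∑ c, ∑ d, ∑ e, (if e = 0 then ε (a + b) *
      (triple q g a c (-(a + c + e)) * triple q g b d (-(b + d + e))
        - triple q g (c + d + e) (-(a + b + c + d + e)) (a + b + e)) else 0)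
      = tripleSum k q ε g ^ 2 - k ^ 2 * tripleSum k q ε g := by
  simp only [Finset.sum_ite_eq', Finset.mem_univ, if_true, add_zero, mul_sub,
    Finset.sum_sub_distrib]
  congr 1
  · rw [sq, tripleSum, Finset.sum_mul_sum]
    refine Finset.sum_congr rfl fun a _ ↦ Finset.sum_congr rfl fun b _ ↦ ?_
    rw [Finset.sum_mul_sum]
    refine Finset.sum_congr rfl fun c _ ↦ Finset.sum_congr rfl fun d _ ↦ ?_
    rw [h.eps_add]; ring
  · have h1 : ∀ a b c : ZMod k, ∑ d, ε (a + b) * triple q g (c + d) (-(a + b + c + d)) (a + b)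
        = ∑ d, ε (a + b) * triple q g (a + b) d (-(a + b + d)) := fun a b c ↦ by
      rw [sum_shift (-c)]
      refine Finset.sum_congr rfl fun d _ ↦ ?_
      rw [triple_swap_right, triple_swap]
      ring_nf
    have h2 : ∀ a : ZMod k, ∑ b, ∑ d, ε (a + b) * triple q g (a + b) d (-(a + b + d))
        = tripleSum k q ε g := fun a ↦ by
      rw [sum_shift (-a)]
      simp only [tripleSum, add_comm a, neg_add_cancel_right]
    simp only [h1, Finset.sum_const, Finset.card_univ, ZMod.card, ← Finset.smul_sum, h2]
    simp only [nsmul_eq_mul]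
    ring

end Pentagon

/-! ### Vanishing diagonals and pairs of edges; products of four Gauss sums -/

section TripleSums

variable {k : ℕ} {q : ℂ} {ε g : ZMod k → ℂ}

/-- The product of four Gauss sums whose characters multiply to the trivial one. -/
noncomputable def quadruple (g : ZMod k → ℂ) (x y z : ZMod k) : ℂ :=
  if x = 0 ∨ y = 0 ∨ z = 0 ∨ x + y + z = 0 then 0 else g x * g y * g z * g (-(x + y + z))

lemma quadruple_swap (x y z : ZMod k) : quadruple g x y z = quadruple g y x z := by
  simp only [quadruple, or_left_comm, mul_comm (g x), add_comm x]

lemma quadruple_swap_right (x y z : ZMod k) : quadruple g x y z = quadruple g x z y := by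
  have h : x + y + z = x + z + y := by ring
  simp only [quadruple, h, or_left_comm, mul_right_comm]

/-- Of the six Gauss sums, those at s and -s combine to a sign times q. The remaining four form an
expression symmetric in `x`, `y`, `z`, so signs can be moved by permuting variables. -/
lemma triplePair_eq (h : GaussSystem q ε g) (x y z : ZMod k) :
    q * triplePair q g (-(x + z)) x y =
      if x + y = 0 ∨ x + z = 0 then 0 else ε (x + z) * quadruple g x y z := by
  have hq := h.q_ne_zero
  have h1 : -(-(x + z) + x) = z := by ring
  have h2 : -(x + z) - y = -(x + y + z) := by ring
  simp only [triplePair, triple, quadruple, h1, h2, neg_neg, neg_eq_zero, add_comm y x]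
  by_cases h3 : x + z = 0
  · simp [h3]
  have h4 := h.g_mul_g_neg _ h3
  by_cases h5 : x + y = 0
  · simp [h5]
  simp only [h3, h5, if_false, false_or, or_false]
  by_cases h6 : x = 0
  · simp [h6]
  by_cases h7 : y = 0
  · simp [h7]
  by_cases h8 : z = 0
  · simp [h8]
  by_cases h9 : x + y + z = 0
  · simp [h9]
  simp only [h6, h7, h8, h9, if_false, or_false]
  field_simp
  linear_combination (g x * g y * g z * g (-(x + y + z))) * h4

variable [NeZero k]

lemma sum_ite_zero {ι : Type*} (s : Finset ι) (p : Prop) [Decidable p] (f : ι → ℂ) :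
    ∑ i ∈ s, (if p then f i else 0) = if p then ∑ i ∈ s, f i else 0 := by
  split_ifs <;> simp

/-- As for a side, except that the triangle term disappears: `c` enters it only through the sign,
and the signs sum to zero. -/
lemma sum_diagonal (h : GaussSystem q ε g) (hε : ∑ x, ε x = 0) :
    ∑ a : ZMod k, ∑ b, ∑ c, ∑ d, ∑ e, (if a = 0 then ε (b + c) *
      (triple q g c e (-(a + c + e)) * triple q g b (c + d + e) (-(a + b + c + d + e))
        - triple q g (a + b + e) d (-(b + d + e))) else 0)
      = tripleSum k q ε g ^ 2 := by
  simp only [sum_ite_zero, Finset.sum_ite_eq', Finset.mem_univ, if_true, zero_add, mul_sub,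
    Finset.sum_sub_distrib]
  have h0 : ∑ b : ZMod k, ∑ c, ∑ d, ∑ e, ε (b + c) * triple q g (b + e) d (-(b + d + e)) = 0 := by
    refine Finset.sum_eq_zero fun b _ ↦ ?_
    simp only [h.eps_add, mul_assoc, ← Finset.mul_sum]
    rw [← Finset.sum_mul, hε]
    ring
  rw [h0, sub_zero]
  have h1 : ∀ b c : ZMod k, ∑ d, ∑ e, ε (b + c) *
      (triple q g c e (-(c + e)) * triple q g b (c + d + e) (-(b + c + d + e))) =
      (∑ e, ε c * triple q g c e (-(c + e))) * ∑ d, ε b * triple q g b d (-(b + d)) := fun b c ↦ by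
    rw [Finset.sum_comm, Finset.sum_mul_sum]
    refine Finset.sum_congr rfl fun e _ ↦ ?_
    rw [sum_shift (-(c + e))]
    refine Finset.sum_congr rfl fun d _ ↦ ?_
    rw [h.eps_add]
    ring_nf
  rw [sq, tripleSum, Finset.sum_mul_sum, Finset.sum_comm]
  exact Finset.sum_congr rfl fun c _ ↦ Finset.sum_congr rfl fun b _ ↦ h1 b c

/-- Two disjoint sides vanish, leaving three free weights: the constant gives k³ and the overlap
gives 𝕊. -/
lemma sum_side_side :
    ∑ a : ZMod k, ∑ b, ∑ c, ∑ d, ∑ e, (if c + d + e = 0 ∧ d = 0 then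
      1 - if e = 0 then 0 else ε (b + -(b + d + e)) * triple q g b a (-(a + b + c + d + e)) *
        triple q g (-(b + d + e)) (-(a + c + e)) (a + b + e) else 0)
      = k ^ 3 - ∑ s, ∑ t, ∑ v, ε (t + v) * triplePair q g s t v := by
  have h1 : ∀ a b : ZMod k, ∑ c, ∑ d, ∑ e, (if c + d + e = 0 ∧ d = 0 then
      1 - if e = 0 then 0 else ε (b + -(b + d + e)) * triple q g b a (-(a + b + c + d + e)) *
        triple q g (-(b + d + e)) (-(a + c + e)) (a + b + e) else 0)
      = k - ∑ v, ε (b + v) * triplePair q g a b v := fun a b ↦ by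
    have h2 : ∀ c d e : ZMod k, (c + d + e = 0 ∧ d = 0) = (d = 0 ∧ e = -c) := fun c d e ↦ by
      grind
    simp only [h2, ite_and, sum_ite_zero, Finset.sum_ite_eq', Finset.mem_univ, if_true]
    rw [Finset.sum_sub_distrib]
    congr 1
    · simp
    · rw [sum_shift b]
      refine Finset.sum_congr rfl fun v _ ↦ ?_
      simp only [triplePair]
      have h3 : (-(v + b) = 0) = (v + b = 0) := by grind
      simp only [h3]
      split_ifs
      · simp
      · rw [triple_swap b, triple_swap (-(b + 0 + _))]
        ring_nf
  simp only [h1, Finset.sum_sub_distrib]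
  simp
  ring

/-- The constant part cancels by summing signs; the overlap gives 𝕊⁻. -/
lemma sum_diagonal_diagonal (h : GaussSystem q ε g) (hε : ∑ x, ε x = 0) :
    ∑ a : ZMod k, ∑ b, ∑ c, ∑ d, ∑ e, (if a = 0 ∧ a + b + e = 0 then ε (b + c + d) -
      if d = 0 then 0 else ε (b + c) * triple q g c e (-(a + c + e)) *
        triple q g b (c + d + e) (-(a + b + c + d + e)) else 0)
      = - ∑ s, ∑ t, ∑ v, ε (s + v) * triplePair q g s t v := by
  have h2 : ∀ a b e : ZMod k, (a = 0 ∧ a + b + e = 0) = (a = 0 ∧ e = -b) := fun a b e ↦ by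
    grind
  simp only [h2, ite_and, sum_ite_zero, Finset.sum_ite_eq', Finset.mem_univ, if_true,
    Finset.sum_sub_distrib]
  have h0 : ∑ b : ZMod k, ∑ c, ∑ d, ε (b + c + d) = 0 := by
    simp only [h.eps_add, ← Finset.mul_sum, hε, mul_zero, Finset.sum_const_zero]
  rw [h0, zero_sub, neg_inj]
  refine Finset.sum_congr rfl fun s _ ↦ ?_
  rw [Finset.sum_comm (f := fun t v ↦ ε (s + v) * triplePair q g s t v)]
  refine Finset.sum_congr rfl fun c _ ↦ ?_
  rw [sum_reflect (-c)]
  refine Finset.sum_congr rfl fun t _ ↦ ?_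
  have h3 : (-c - t = 0) = (c + t = 0) := by grind
  simp only [triplePair, h3]
  split_ifs
  · simp
  · rw [triple_swap_right s t, triple_swap (-s)]
    ring_nf

/-- The constant part cancels again. The sign left on the overlap is neither that of 𝕊 nor that of
𝕊⁻; `sum_triplePair_sub` converts it to 𝕊. -/
lemma sum_side_diagonal_eq (h : GaussSystem q ε g) (hε : ∑ x, ε x = 0) :
    ∑ a : ZMod k, ∑ b, ∑ c, ∑ d, ∑ e, (if d = 0 ∧ a = 0 then ε (-(a + c + e)) -
      if a + b + e = 0 then 0 else ε (b + c) * triple q g c e (-(a + c + e)) *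
        triple q g b (c + d + e) (-(a + b + c + d + e)) else 0)
      = - ∑ s, ∑ t, ∑ v, ε (s + t + v) * triplePair q g s t v := by
  have h2 : ∀ a d : ZMod k, (d = 0 ∧ a = 0) = (a = 0 ∧ d = 0) := fun a b ↦ by
    grind
  simp only [h2, ite_and, sum_ite_zero, Finset.sum_ite_eq', Finset.mem_univ, if_true,
    Finset.sum_sub_distrib]
  have h0 : ∑ b : ZMod k, ∑ c : ZMod k, ∑ e, ε (-(0 + c + e)) = 0 := by
    simp only [h.eps_add, h.eps_neg, ← Finset.mul_sum, hε, mul_zero, Finset.sum_const_zero]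
  rw [h0, zero_sub, neg_inj,
    Finset.sum_comm (f := fun s t ↦ ∑ v, ε (s + t + v) * triplePair q g s t v)]
  refine Finset.sum_congr rfl fun t _ ↦ ?_
  rw [Finset.sum_comm, Finset.sum_comm (f := fun s v ↦ ε (s + t + v) * triplePair q g s t v)]
  refine Finset.sum_congr rfl fun v _ ↦ ?_
  rw [sum_shift (-v)]
  refine Finset.sum_congr rfl fun s _ ↦ ?_
  have h3 : (0 + t + v = 0) = (v + t = 0) := by grind
  have h4 : ε (t + (s + -v)) = ε (s + t + v) := by
    simp only [h.eps_add, h.eps_neg]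
    ring
  simp only [triplePair, h3, h4]
  split_ifs
  · simp
  · rw [triple_swap t, triple_swap_right (-s) v, triple_swap (-s) (s - v),
      triple_swap_right (s - v) (-s)]
    ring_nf

/-- Sums over pairs of Jacobi sums, in terms of products of four Gauss sums. -/
lemma sum_triplePair (h : GaussSystem q ε g) (f : ZMod k → ZMod k → ZMod k → ℂ) :
    q * ∑ s, ∑ t, ∑ v, f s t v * triplePair q g s t v =
      ∑ x, ∑ y, ∑ z, f (-(x + z)) x y *
        if x + y = 0 ∨ x + z = 0 then 0 else ε (x + z) * quadruple g x y z := by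
  simp only [← triplePair_eq h]
  rw [Finset.sum_comm]
  simp only [Finset.mul_sum]
  refine Finset.sum_congr rfl fun x _ ↦ ?_
  rw [Finset.sum_comm]
  refine Finset.sum_congr rfl fun y _ ↦ ?_
  rw [sum_reflect (-x)]
  refine Finset.sum_congr rfl fun z _ ↦ ?_
  rw [show -x - z = -(x + z) by ring]
  ring

end TripleSums

/-! ### The total of the degenerate terms -/

section DegenerateSum

variable {k : ℕ} {q : ℂ} {ε g : ZMod k → ℂ}

lemma quadruple_neg (h : GaussSystem q ε g) (x z : ZMod k) :
    quadruple g x (-x) z = if x = 0 ∨ z = 0 then 0 else q ^ 2 * ε (x + z) := by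
  simp only [quadruple, add_neg_cancel, zero_add, neg_eq_zero, or_self]
  by_cases hx : x = 0
  · simp [hx]
  by_cases hz : z = 0
  · simp [hz]
  simp only [hx, hz, or_self, if_false]
  rw [mul_assoc, h.g_mul_g_neg x hx, h.g_mul_g_neg z hz, h.eps_add]
  ring

variable [NeZero k]

/-- A nonzero element is x + z with x, z ≠ 0 in exactly k - 2 ways. -/
lemma sum_sum_nondegenerate (f : ZMod k → ℂ) :
    ∑ x : ZMod k, ∑ z, (if x = 0 ∨ z = 0 ∨ x + z = 0 then 0 else f (x + z)) =
      (k - 2) * ∑ x, f x - (k - 2) * f 0 := by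
  have h1 : ∀ x z : ZMod k, (if x = 0 ∨ z = 0 ∨ x + z = 0 then 0 else f (x + z)) =
      f (x + z) - (if x = 0 then f z else 0) - (if z = 0 then f x else 0)
        - (if z = -x then f 0 else 0) + (if x = 0 then if z = 0 then 2 * f 0 else 0 else 0) := by
    intro x z
    have e : (z = -x) = (x + z = 0) := by grind
    simp only [e]
    by_cases hx : x = 0
    · subst hx
      by_cases hz : z = 0
      · simp [hz]; ring
      · simp [hz]
    · by_cases hz : z = 0
      · simp [hz, hx]
      · by_cases hxz : x + z = 0
        · simp [hx, hz, hxz]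
        · simp [hx, hz, hxz]
  have h2 : ∀ x : ZMod k, ∑ z, f (x + z) = ∑ z, f z := fun x ↦ by
    rw [sum_shift x f]
    simp only [add_comm]
  simp only [h1, h2, Finset.sum_add_distrib, Finset.sum_sub_distrib, sum_ite_zero,
    Finset.sum_ite_eq', Finset.mem_univ, if_true, Finset.sum_const, Finset.card_univ, ZMod.card,
    nsmul_eq_mul]
  ring

/-- After permuting variables both sides sum the same signed `quadruple` and differ only in the
excluded terms. The discrepancy lives on y = -x and y = -z, where two pairs of Gauss sums cancel to
±q²; counting these terms gives k(k-2)q², one factor q being divided out. -/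
lemma sum_triplePair_sub (h : GaussSystem q ε g) (hε : ∑ x, ε x = 0) :
    ∑ s, ∑ t, ∑ v, ε (s + t + v) * triplePair q g s t v =
      ∑ s, ∑ t, ∑ v, ε (t + v) * triplePair q g s t v + q * k * (k - 2) := by
  have hq := h.q_ne_zero
  apply mul_left_cancel₀ hq
  rw [mul_add, sum_triplePair h (fun s t v ↦ ε (s + t + v)),
    sum_triplePair h (fun s t v ↦ ε (t + v))]
  have h1 : ∑ x : ZMod k, ∑ y, ∑ z, (ε (-(x + z) + x + y) *
        if x + y = 0 ∨ x + z = 0 then 0 else ε (x + z) * quadruple g x y z) =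
      ∑ x : ZMod k, ∑ y, ∑ z,
        if y + z = 0 ∨ x + z = 0 then 0 else ε (y + z) * quadruple g x y z := by
    have : ∀ y : ZMod k, ∑ x : ZMod k, ∑ z, (ε (-(x + z) + x + y) *
        if x + y = 0 ∨ x + z = 0 then 0 else ε (x + z) * quadruple g x y z) = ∑ x : ZMod k, ∑ z,
        if y + z = 0 ∨ x + z = 0 then 0 else ε (y + z) * quadruple g x y z := fun y ↦ by
      rw [Finset.sum_comm]
      refine Finset.sum_congr rfl fun z _ ↦ Finset.sum_congr rfl fun x _ ↦ ?_
      rw [add_comm x y, add_comm z x]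
      split_ifs
      · ring
      · rw [quadruple_swap x, quadruple_swap_right y, quadruple_swap y]
        simp only [h.eps_add, h.eps_neg]
        linear_combination (ε x * ε y * quadruple g z y x) * (ε z ^ 2 * h.eps_sq x + h.eps_sq z)
    rw [Finset.sum_comm, Finset.sum_congr rfl fun y _ ↦ this y, Finset.sum_comm]
  have h2 : ∀ x y z : ZMod k, (ε (x + y) *
        if x + y = 0 ∨ x + z = 0 then 0 else ε (x + z) * quadruple g x y z) =
        if x + y = 0 ∨ x + z = 0 then 0 else ε (y + z) * quadruple g x y z := fun x y z ↦ by
    split_ifs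
    · ring
    · simp only [h.eps_add]
      linear_combination (ε y * ε z * quadruple g x y z) * h.eps_sq x
  rw [h1]
  simp only [h2]
  rw [← sub_eq_iff_eq_add']
  simp only [← Finset.sum_sub_distrib]
  have h3 : ∀ x y z : ZMod k,
      ((if y + z = 0 ∨ x + z = 0 then 0 else ε (y + z) * quadruple g x y z) -
        if x + y = 0 ∨ x + z = 0 then 0 else ε (y + z) * quadruple g x y z) =
      (if y = -x then if x = 0 ∨ z = 0 ∨ x + z = 0 then 0 else q ^ 2 else 0) -
        if y = -z then if x = 0 ∨ z = 0 ∨ x + z = 0 then 0 else q ^ 2 * ε (x + z) else 0 := by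
    intro x y z
    have e1 : (y + z = 0) = (y = -z) := by grind
    have e2 : (x + y = 0) = (y = -x) := by grind
    simp only [e1, e2]
    by_cases hxz : x + z = 0
    · simp [hxz]
    simp only [hxz, or_false]
    have h4 : y = -x → ε (y + z) * quadruple g x y z =
        if x = 0 ∨ z = 0 then 0 else q ^ 2 := by
      rintro rfl
      rw [quadruple_neg h]
      split_ifs
      · ring
      · simp only [h.eps_add, h.eps_neg]
        linear_combination q ^ 2 * ε z ^ 2 * h.eps_sq x + q ^ 2 * h.eps_sq z
    have h5 : y = -z → ε (y + z) * quadruple g x y z =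
        if x = 0 ∨ z = 0 then 0 else q ^ 2 * ε (x + z) := by
      rintro rfl
      rw [quadruple_swap_right, quadruple_swap, quadruple_swap_right, quadruple_neg h,
        neg_add_cancel, h.eps_zero, one_mul]
      simp only [or_comm, add_comm]
    by_cases h6 : y = -x <;> by_cases h7 : y = -z
    · simp only [if_pos h6, if_pos h7, ← h4 h6, ← h5 h7]
      ring
    · simp only [h6, if_true]
      rw [← h6, if_neg h7, h4 h6, if_neg h7]
    · simp only [if_neg h6, if_pos h7]
      rw [h5 h7]
    · simp only [if_neg h6, if_neg h7]
      ring
  simp only [h3, Finset.sum_sub_distrib]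
  have h4 : ∀ x : ZMod k, ∑ y : ZMod k, ∑ z : ZMod k,
      (if y = -x then if x = 0 ∨ z = 0 ∨ x + z = 0 then 0 else q ^ 2 else 0) =
      ∑ z, if x = 0 ∨ z = 0 ∨ x + z = 0 then 0 else q ^ 2 := fun x ↦ by
    simp only [sum_ite_zero, Finset.sum_ite_eq', Finset.mem_univ, if_true]
  have h5 : ∀ x : ZMod k, ∑ y : ZMod k, ∑ z : ZMod k,
      (if y = -z then if x = 0 ∨ z = 0 ∨ x + z = 0 then 0 else q ^ 2 * ε (x + z) else 0) =
      ∑ z, if x = 0 ∨ z = 0 ∨ x + z = 0 then 0 else q ^ 2 * ε (x + z) := fun x ↦ by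
    rw [Finset.sum_comm]
    simp only [Finset.sum_ite_eq', Finset.mem_univ, if_true]
  simp only [h4, h5]
  rw [sum_sum_nondegenerate (fun _ ↦ q ^ 2), sum_sum_nondegenerate (fun u ↦ q ^ 2 * ε u),
    ← Finset.mul_sum, hε, h.eps_zero]
  simp
  ring

lemma sum_degenerateTerm (h : GaussSystem q ε g) (hε : ∑ x, ε x = 0) :
    ∑ t, onEdges (degenerateTerm q ε g) t =
      2 * tripleSum k q ε g ^ 2 - k ^ 2 * tripleSum k q ε g + (q + 1) * tripleSum k q ε g
        + k ^ 3 - 2 * ∑ s, ∑ t, ∑ v, ε (t + v) * triplePair q g s t v - q * k * (k - 2)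
        - ∑ s, ∑ t, ∑ v, ε (s + v) * triplePair q g s t v
        - k ^ 2 * (q + 1) + 2 * q * k + (q ^ 2 - 10 * q + 1) / 5 := by
  simp only [Fintype.sum_prod_type, onEdges, degenerateTerm, Finset.sum_add_distrib,
    Finset.sum_sub_distrib]
  have t6 : ∑ a : ZMod k, ∑ b : ZMod k, ∑ c : ZMod k, ∑ d : ZMod k, ∑ e : ZMod k,
      (if d = 0 ∧ -(a + c + e) = 0 ∧ c + d + e = 0 ∧ a = 0 then q + 1 else 0)
      = k ^ 2 * (q + 1) := by
    have e1 : ∀ a c d e : ZMod k, (d = 0 ∧ -(a + c + e) = 0 ∧ c + d + e = 0 ∧ a = 0) =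
        (a = 0 ∧ d = 0 ∧ e = -c) := fun a c d e ↦ by grind
    simp only [e1, ite_and, sum_ite_zero, Finset.sum_ite_eq', Finset.mem_univ, if_true]
    simp
    ring
  have t7 : ∑ a : ZMod k, ∑ b : ZMod k, ∑ c : ZMod k, ∑ d : ZMod k, ∑ e : ZMod k,
      (if a = 0 ∧ a + b + e = 0 ∧ d = 0 ∧ -(b + d + e) = 0 then (q + 1) * ε (-(a + c + e)) else 0)
      = 0 := by
    have e1 : ∀ a b d e : ZMod k, (a = 0 ∧ a + b + e = 0 ∧ d = 0 ∧ -(b + d + e) = 0) =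
        (a = 0 ∧ d = 0 ∧ e = -b) := fun a b d e ↦ by grind
    simp only [e1, ite_and, sum_ite_zero, Finset.sum_ite_eq', Finset.mem_univ, if_true, h.eps_neg,
      h.eps_add, ← Finset.mul_sum, ← Finset.sum_mul, hε]
    ring
  have t8 : ∑ a : ZMod k, ∑ b : ZMod k, ∑ c : ZMod k, ∑ d : ZMod k, ∑ e : ZMod k,
      (if e = 0 ∧ -(a + c + e) = 0 ∧ a = 0 ∧ c = 0 then
        (q + 1) * ε (a + b + e) * triple q g (c + d + e) (-(a + b + c + d + e)) (a + b + e)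
          + (if c + d + e = 0 ∧ d = 0 then q else 0)
          + (if -(b + d + e) = 0 ∧ -(a + b + c + d + e) = 0 then q else 0)
          + (if a + b + e = 0 ∧ b = 0 then q * ε (c + d + e) else 0) else 0)
      = (q + 1) * tripleSum k q ε g + 2 * q * k := by
    have e1 : ∀ a c e : ZMod k, (e = 0 ∧ -(a + c + e) = 0 ∧ a = 0 ∧ c = 0) =
        (a = 0 ∧ c = 0 ∧ e = 0) := fun a c e ↦ by grind
    have e2 : ∀ b d : ZMod k, (-(b + d) = 0) = (d = -b) := fun b d ↦ by grind
    simp only [e1, ite_and]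
    simp only [sum_ite_zero, Finset.sum_ite_eq', Finset.mem_univ, if_true, zero_add, add_zero]
    simp only [Finset.sum_add_distrib, e2, sum_ite_zero, Finset.sum_ite_eq', Finset.mem_univ,
      if_true]
    have e3 : ∀ x y : ZMod k, triple q g y (-(x + y)) x = triple q g x y (-(x + y)) := fun x y ↦ by
      rw [triple_swap_right, triple_swap]
    simp only [e3, mul_assoc, ← Finset.mul_sum, hε, Finset.sum_const, Finset.card_univ, ZMod.card,
      nsmul_eq_mul, tripleSum]
    ring
  have t9 : ∑ a : ZMod k, ∑ b : ZMod k, ∑ c : ZMod k, ∑ d : ZMod k, ∑ e : ZMod k,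
      (if c + d + e = 0 ∧ -(a + b + c + d + e) = 0 ∧ d = 0 ∧ e = 0 ∧ -(a + c + e) = 0 ∧
        a + b + e = 0 ∧ b = 0 ∧ c = 0 ∧ -(b + d + e) = 0 ∧ a = 0
        then (q ^ 2 - 10 * q + 1) / 5 else 0) = (q ^ 2 - 10 * q + 1) / 5 := by
    have e1 : ∀ a b c d e : ZMod k, (c + d + e = 0 ∧ -(a + b + c + d + e) = 0 ∧ d = 0 ∧ e = 0 ∧
        -(a + c + e) = 0 ∧ a + b + e = 0 ∧ b = 0 ∧ c = 0 ∧ -(b + d + e) = 0 ∧ a = 0) =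
        (a = 0 ∧ b = 0 ∧ c = 0 ∧ d = 0 ∧ e = 0) := fun a b c d e ↦ by grind
    simp only [e1, ite_and, sum_ite_zero, Finset.sum_ite_eq', Finset.mem_univ, if_true]
  rw [sum_side h, sum_diagonal h hε, sum_side_side, sum_side_diagonal_eq h hε,
    sum_diagonal_diagonal h hε, t6, t7, t8, t9, sum_triplePair_sub h hε]
  ring

end DegenerateSum

/-! ### Powers of χ, their Gauss and Jacobi sums, and collapsing pentagon sums -/

section Characters

set_option linter.unusedSectionVars false

variable {F : Type*} [Field F] {k : ℕ} [NeZero k] {χ : MulChar F ℂ}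

/-- The power of a character of order `k` with exponent in `ℤ/k`. -/
noncomputable def charPow (χ : MulChar F ℂ) (s : ZMod k) : MulChar F ℂ := χ ^ s.val

/-- The sign `χ ^ s` takes at `-1`. -/
noncomputable def charSign (χ : MulChar F ℂ) (s : ZMod k) : ℂ := charPow χ s (-1)

lemma charPow_zero : charPow χ (0 : ZMod k) = 1 := by simp [charPow]

lemma charPow_add (hχ : orderOf χ = k) (s t : ZMod k) :
    charPow χ (s + t) = charPow χ s * charPow χ t := by
  simp only [charPow, ZMod.val_add, ← pow_add]
  conv_rhs => rw [← pow_mod_orderOf, hχ]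

lemma charPow_neg (hχ : orderOf χ = k) (s : ZMod k) : charPow χ (-s) = (charPow χ s)⁻¹ := by
  rw [eq_inv_iff_mul_eq_one, ← charPow_add hχ, neg_add_cancel, charPow_zero]

lemma charPow_sub (hχ : orderOf χ = k) (s t : ZMod k) :
    charPow χ (s - t) = charPow χ s * (charPow χ t)⁻¹ := by
  rw [sub_eq_add_neg, charPow_add hχ, charPow_neg hχ]

lemma charPow_eq_one (hχ : orderOf χ = k) {s : ZMod k} : charPow χ s = 1 ↔ s = 0 := by
  rw [charPow, ← orderOf_dvd_iff_pow_eq_one, hχ, ← ZMod.natCast_eq_zero_iff, ZMod.natCast_zmod_val]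

lemma charPow_zero_apply {x : F} (hx : x ≠ 0) : charPow χ (0 : ZMod k) x = 1 := by
  rw [charPow_zero, MulChar.one_apply (isUnit_iff_ne_zero.mpr hx)]

lemma charSign_add (hχ : orderOf χ = k) (s t : ZMod k) :
    charSign χ (s + t) = charSign χ s * charSign χ t := by
  rw [charSign, charPow_add hχ, MulChar.mul_apply]; rfl

lemma charSign_eq (hneg : χ (-1) = -1) (s : ZMod k) : charSign χ s = (-1) ^ s.val := by
  have := MulChar.pow_apply_coe χ s.val (-1 : Fˣ)
  rw [Units.val_neg, Units.val_one, hneg] at this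
  exact this

lemma charSign_sq (hneg : χ (-1) = -1) (s : ZMod k) : charSign χ s ^ 2 = 1 := by
  rw [charSign_eq hneg, ← pow_mul, mul_comm, pow_mul]
  norm_num

lemma charPow_neg_apply (s : ZMod k) (x : F) :
    charPow χ s (-x) = charSign χ s * charPow χ s x := by
  rw [charSign, ← map_mul, neg_one_mul]

lemma charPow_sub_comm (s : ZMod k) (x y : F) :
    charPow χ s (x - y) = charSign χ s * charPow χ s (y - x) := by
  rw [← charPow_neg_apply, neg_sub]

lemma sum_charSign (hk : 2 ≤ k) (hχ : orderOf χ = k) (hneg : χ (-1) = -1) :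
    ∑ s : ZMod k, charSign χ s = 0 := by
  have h1 : charSign χ (1 : ZMod k) = -1 := by
    have : Fact (1 < k) := ⟨hk⟩
    rw [charSign_eq hneg, ZMod.val_one, pow_one]
  have h2 := sum_shift (1 : ZMod k) (charSign χ)
  simp only [charSign_add hχ, h1, ← Finset.sum_mul] at h2
  linear_combination (1 / 2) * h2

variable [Fintype F]

/-- The Gauss sum of `χ ^ s` with respect to a standard additive character. -/
noncomputable def charGauss (χ : MulChar F ℂ) (s : ZMod k) : ℂ :=
  gaussSum (charPow χ s) (AddChar.FiniteField.primitiveChar_to_Complex F)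

lemma gaussSystem (hχ : orderOf χ = k) (hneg : χ (-1) = -1) :
    GaussSystem (k := k) (Fintype.card F : ℂ) (charSign χ) (charGauss χ) where
  q_ne_zero := Nat.cast_ne_zero.mpr Fintype.card_ne_zero
  eps_add := charSign_add hχ
  eps_sq := charSign_sq hneg
  g_mul_g_neg x hx := by
    have h1 : charPow χ x ≠ 1 := fun h ↦ hx ((charPow_eq_one hχ).mp h)
    have h2 := gaussSum_mul_gaussSum_eq_card h1
      (AddChar.FiniteField.primitiveChar_to_Complex_isPrimitive F)
    have h3 := mul_gaussSum_inv_eq_gaussSum (charPow χ x)⁻¹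
      (AddChar.FiniteField.primitiveChar_to_Complex F)
    have h4 : (charPow χ x)⁻¹ (-1) = charSign χ x := by
      rw [MulChar.inv_apply', charSign, inv_neg, inv_one]
    rw [charGauss, charGauss, charPow_neg hχ, ← h3, h4, ← h2]
    ring

/-- Jacobi sums of powers of `χ` in symmetric form. -/
lemma charSign_mul_jacobiSum (hχ : orderOf χ = k) (hneg : χ (-1) = -1) {x y z : ZMod k}
    (h : x + y + z = 0) : charSign χ z * jacobiSum (charPow χ x) (charPow χ y) =
      fullTriple (Fintype.card F : ℂ) (charSign χ) (charGauss χ) x y z := by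
  have hS := gaussSystem hχ hneg
  have hq := hS.q_ne_zero
  have ez : charSign χ z = charSign χ x * charSign χ y := by
    rw [← hS.eps_add, ← hS.eps_neg, eq_neg_of_add_eq_zero_left h]
  rw [fullTriple, triple]
  by_cases hx : x = 0
  · subst hx
    by_cases hy : y = 0
    · obtain rfl : z = 0 := by simpa [hy] using h
      subst hy
      simp only [charPow_zero, jacobiSum_one_one, hS.eps_zero, true_or, if_true, and_self]
      ring
    · have hz : z ≠ 0 := by rintro rfl; simp_all
      have h1 : charPow χ y ≠ 1 := fun h ↦ hy ((charPow_eq_one hχ).mp h)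
      rw [charPow_zero, jacobiSum_one_nontrivial h1, ez, hS.eps_zero]
      simp [hy, hz]
  · have h1 : charPow χ x ≠ 1 := fun h ↦ hx ((charPow_eq_one hχ).mp h)
    by_cases hy : y = 0
    · subst hy
      have hz : z ≠ 0 := by rintro rfl; simp_all
      rw [charPow_zero, jacobiSum_comm, jacobiSum_one_nontrivial h1]
      simp [hx, hz]
    · by_cases hz : z = 0
      · subst hz
        obtain rfl : y = -x := by rw [add_zero] at h; exact eq_neg_of_add_eq_zero_right h
        rw [charPow_neg hχ, jacobiSum_nontrivial_inv h1, hS.eps_zero]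
        simp [hx, charSign]
      · have h2 : charPow χ x * charPow χ y ≠ 1 := by
          rw [← charPow_add hχ]
          intro h3
          rw [(charPow_eq_one hχ).mp h3, zero_add] at h
          exact hz h
        have h3 := jacobiSum_mul_nontrivial h2 (AddChar.FiniteField.primitiveChar_to_Complex F)
        rw [← charPow_add hχ, eq_neg_of_add_eq_zero_left h] at h3
        have h4 := hS.g_mul_g_neg z hz
        simp only [hx, hy, hz, or_self, if_false, sub_zero, and_self, add_zero]
        rw [eq_div_iff hq]
        have h5 := congrArg (charGauss χ z * ·) h3
        simp only [← charGauss.eq_1] at h5 h4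
        linear_combination h5 - jacobiSum (charPow χ x) (charPow χ y) * h4

lemma sum_charPow_mul_sub_one (s t : ZMod k) :
    ∑ y, charPow χ s y * charPow χ t (y - 1) =
      charSign χ t * jacobiSum (charPow χ s) (charPow χ t) := by
  rw [jacobiSum, Finset.mul_sum]
  refine Finset.sum_congr rfl fun y _ ↦ ?_
  rw [charPow_sub_comm]
  ring

/-- The character sum over the configurations `∞, 0, 1, z, y` of five distinct points. -/
noncomputable def pentagonSum (χ : MulChar F ℂ) : PentagonWeight k → ℂ
  | (a, b, c, d, e) => ∑ y, ∑ z, charPow χ a y * charPow χ b z * charPow χ c (y - 1) *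
      charPow χ d (z - 1) * charPow χ e (y - z)

/-- The trivial character at y - z only excludes z = y, so the double sum is a product of two single
sums minus its diagonal. -/
lemma pentagonSum_side (hχ : orderOf χ = k) (a b c d : ZMod k) :
    pentagonSum χ (a, b, c, d, 0) = charSign χ (c + d) *
      (jacobiSum (charPow χ a) (charPow χ c) * jacobiSum (charPow χ b) (charPow χ d)
        - jacobiSum (charPow χ (a + b)) (charPow χ (c + d))) := by
  classical
  have h1 : ∀ y z : F, charPow χ a y * charPow χ b z * charPow χ c (y - 1) *
      charPow χ d (z - 1) * charPow χ (0 : ZMod k) (y - z) =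
      (charPow χ a y * charPow χ c (y - 1)) * (charPow χ b z * charPow χ d (z - 1)) -
      if z = y then charPow χ (a + b) y * charPow χ (c + d) (y - 1) else 0 := fun y z ↦ by
    split_ifs with h
    · subst h
      rw [charPow_add hχ, charPow_add hχ, MulChar.mul_apply, MulChar.mul_apply, sub_self,
        MulChar.map_zero]
      ring
    · rw [charPow_zero_apply (sub_ne_zero.mpr (Ne.symm h))]
      ring
  simp only [pentagonSum, h1, Finset.sum_sub_distrib, Finset.sum_ite_eq', Finset.mem_univ, if_true,
    ← Finset.sum_mul_sum, sum_charPow_mul_sub_one]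
  rw [charSign_add hχ]
  ring

/-- The trivial character at y only excludes y = 0. The full inner sum over y becomes a Jacobi sum
through y = (z-1)u + 1. -/
lemma pentagonSum_diagonal (hχ : orderOf χ = k) (b c d e : ZMod k) :
    pentagonSum χ (0, b, c, d, e) = charSign χ (c + d + e) * (charSign χ e *
      jacobiSum (charPow χ c) (charPow χ e) * jacobiSum (charPow χ b) (charPow χ (c + d + e))
        - jacobiSum (charPow χ (b + e)) (charPow χ d)) := by
  classical
  have h1 : ∀ z : F, ∑ y, charPow χ (0 : ZMod k) y * charPow χ b z * charPow χ c (y - 1) *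
      charPow χ d (z - 1) * charPow χ e (y - z) =
      (charPow χ b z * charPow χ (c + d + e) (z - 1)) *
        (charSign χ e * jacobiSum (charPow χ c) (charPow χ e)) -
      charSign χ c * charSign χ e * (charPow χ (b + e) z * charPow χ d (z - 1)) := fun z ↦ by
    by_cases hz : z = 1
    · subst hz
      simp [MulChar.map_zero]
    have hz' : z - 1 ≠ 0 := sub_ne_zero.mpr hz
    have h2 : ∀ y : F, charPow χ (0 : ZMod k) y * charPow χ b z * charPow χ c (y - 1) *
        charPow χ d (z - 1) * charPow χ e (y - z) =
        charPow χ b z * charPow χ d (z - 1) * (charPow χ c (y - 1) * charPow χ e (y - z)) -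
        if y = 0 then charSign χ c * charSign χ e *
          (charPow χ (b + e) z * charPow χ d (z - 1)) else 0 := fun y ↦ by
      split_ifs with h
      · subst h
        rw [charPow_add hχ, MulChar.mul_apply, MulChar.map_zero, zero_sub, zero_sub,
          charPow_neg_apply e]
        simp only [charSign]
        ring
      · rw [charPow_zero_apply h]
        ring
    have h3 : ∑ y, charPow χ c (y - 1) * charPow χ e (y - z) = charPow χ c (z - 1) *
        charPow χ e (z - 1) * (charSign χ e * jacobiSum (charPow χ c) (charPow χ e)) := by
      rw [← sum_charPow_mul_sub_one, Finset.mul_sum,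
        ← Equiv.sum_comp ((Equiv.mulLeft₀ _ hz').trans (Equiv.addRight 1))]
      refine Finset.sum_congr rfl fun u _ ↦ ?_
      change charPow χ c ((z - 1) * u + 1 - 1) * charPow χ e ((z - 1) * u + 1 - z) = _
      rw [add_sub_cancel_right, show (z - 1) * u + 1 - z = (z - 1) * (u - 1) by ring, map_mul, map_mul]
      ring
    simp only [h2, Finset.sum_sub_distrib, ← Finset.mul_sum, h3, Finset.sum_ite_eq',
      Finset.mem_univ, if_true, charPow_add hχ, MulChar.mul_apply]
    ring
  rw [pentagonSum, Finset.sum_comm, Finset.sum_congr rfl fun z _ ↦ h1 z, Finset.sum_sub_distrib,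
    ← Finset.sum_mul, ← Finset.mul_sum, sum_charPow_mul_sub_one, sum_charPow_mul_sub_one,
    charSign_add hχ, charSign_add hχ]
  ring

end Characters

/-! ### Cyclic symmetry of pentagon sums and their degenerate values -/

section Characters

variable {F : Type*} [Field F] [Fintype F] {k : ℕ} [NeZero k] {χ : MulChar F ℂ}

/-- Relabel ∞, 0, 1, z, y cyclically and renormalise by a Möbius map. Since the weights at each
point sum to zero, the scaling factors cancel. -/
lemma pentagonSum_rotate (hχ : orderOf χ = k) (t : PentagonWeight k) :
    pentagonSum χ (pentagonRotate k t) = pentagonSum χ t := by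
  classical
  obtain ⟨a, b, c, d, e⟩ := t
  simp only [pentagonSum, pentagonRotate, Equiv.coe_fn_mk, ← Finset.sum_product']
  let D : Finset (F × F) := {p | p.1 ≠ 0 ∧ p.1 ≠ 1 ∧ p.2 ≠ 0 ∧ p.2 ≠ 1 ∧ p.1 ≠ p.2}
  have hD : ∀ (a b c d e : ZMod k) (p : F × F), p ∉ D → charPow χ a p.1 * charPow χ b p.2 *
      charPow χ c (p.1 - 1) * charPow χ d (p.2 - 1) * charPow χ e (p.1 - p.2) = 0 := by
    rintro a b c d e ⟨y, z⟩ hp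
    simp only [D, Finset.mem_filter, Finset.mem_univ, true_and] at hp
    by_cases h1 : y = 0
    · simp [h1, MulChar.map_zero]
    by_cases h2 : y = 1
    · simp [h2, MulChar.map_zero]
    by_cases h3 : z = 0
    · simp [h3, MulChar.map_zero]
    by_cases h4 : z = 1
    · simp [h4, MulChar.map_zero]
    by_cases h5 : y = z
    · simp [h5, MulChar.map_zero]
    exact absurd ⟨h1, h2, h3, h4, h5⟩ hp
  rw [Finset.univ_product_univ, ← Finset.sum_subset (Finset.subset_univ D) fun p _ hp ↦ hD _ _ _ _ _ p hp,
    ← Finset.sum_subset (Finset.subset_univ D) fun p _ hp ↦ hD _ _ _ _ _ p hp]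
  have hmem : ∀ y z : F, (y, z) ∈ D ↔ y ≠ 0 ∧ y ≠ 1 ∧ z ≠ 0 ∧ z ≠ 1 ∧ y ≠ z := by
    simp [D]
  -- The inverse map sends (y, z) to (φ(∞), φ(y)), where φ(w) = z(w-1)/((z-1)w) takes 0, 1, z to ∞,
  -- 0, 1.
  refine Finset.sum_bij' (fun p _ ↦ (p.1 / (p.1 - p.2), p.1 / (p.1 - 1)))
    (fun p _ ↦ (p.2 / (p.2 - 1), p.2 * (p.1 - 1) / ((p.2 - 1) * p.1))) ?_ ?_ ?_ ?_ ?_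
  · rintro ⟨y, z⟩ h
    rw [hmem] at h ⊢
    obtain ⟨h1, h2, h3, h4, h5⟩ := h
    have h6 := sub_ne_zero.mpr h2
    have h7 := sub_ne_zero.mpr h5
    refine ⟨div_ne_zero h1 h7, fun h ↦ ?_, div_ne_zero h1 h6, fun h ↦ ?_, fun h ↦ ?_⟩
    · rw [div_eq_one_iff_eq h7] at h
      exact h3 (by linear_combination h)
    · rw [div_eq_one_iff_eq h6] at h
      exact one_ne_zero (α := F) (by linear_combination h)
    · rw [div_eq_div_iff h7 h6] at h
      exact h4 (mul_left_cancel₀ h1 (by linear_combination h))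
  · rintro ⟨y, z⟩ h
    rw [hmem] at h ⊢
    obtain ⟨h1, h2, h3, h4, h5⟩ := h
    have h6 := sub_ne_zero.mpr h2
    have h7 := sub_ne_zero.mpr h4
    have h8 := mul_ne_zero h7 h1
    refine ⟨div_ne_zero h3 h7, fun h ↦ ?_, div_ne_zero (mul_ne_zero h3 h6) h8, fun h ↦ ?_,
      fun h ↦ ?_⟩
    · rw [div_eq_one_iff_eq h7] at h
      exact one_ne_zero (α := F) (by linear_combination h)
    · rw [div_eq_one_iff_eq h8] at h
      exact h5 (by linear_combination h)
    · rw [div_eq_div_iff h7 h8] at h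
      exact one_ne_zero (α := F) (mul_left_cancel₀ (mul_ne_zero h3 h7) (by linear_combination h))
  · rintro ⟨y, z⟩ h
    rw [hmem] at h
    obtain ⟨h1, h2, h3, h4, h5⟩ := h
    have h6 := sub_ne_zero.mpr h2
    have h7 := sub_ne_zero.mpr h5
    have h8 : y / (y - 1) - 1 = 1 / (y - 1) := by field_simp; ring
    have h9 : y / (y - z) - 1 = z / (y - z) := by field_simp; ring
    ext
    · simp only [h8]; field_simp
    · simp only [h8, h9]; field_simp
  · rintro ⟨y, z⟩ h
    rw [hmem] at h
    obtain ⟨h1, h2, h3, h4, h5⟩ := h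
    have h6 := sub_ne_zero.mpr h2
    have h7 := sub_ne_zero.mpr h4
    have h8 : z / (z - 1) - 1 = 1 / (z - 1) := by field_simp; ring
    have h9 : z / (z - 1) - z * (y - 1) / ((z - 1) * y) = z / ((z - 1) * y) := by
      field_simp; ring
    ext
    · simp only [h9]; field_simp
    · simp only [h8]; field_simp
  · rintro ⟨y, z⟩ h
    rw [hmem] at h
    obtain ⟨h1, h2, h3, h4, h5⟩ := h
    have h6 := sub_ne_zero.mpr h2
    have h7 := sub_ne_zero.mpr h5
    have h8 : y / (y - 1) - 1 = 1 / (y - 1) := by field_simp; ring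
    have h9 : y / (y - z) - 1 = z / (y - z) := by field_simp; ring
    have h10 : y / (y - z) - y / (y - 1) = y * (z - 1) / ((y - z) * (y - 1)) := by
      field_simp; ring
    have hz1 := sub_ne_zero.mpr h4
    have hu : ∀ (s : ZMod k) (x : F), x ≠ 0 → charPow χ s x ≠ 0 := fun s x hx ↦
      MulChar.apply_ne_zero_iff.mpr (isUnit_iff_ne_zero.mpr hx)
    have hdiv : ∀ (s : ZMod k) (x y : F), charPow χ s (x / y) = charPow χ s x / charPow χ s y :=
      fun s x y ↦ by
        rw [div_eq_mul_inv, map_mul, ← MulChar.inv_apply', MulChar.inv_apply_eq_inv',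
          div_eq_mul_inv]
    simp only [h8, h9, h10, hdiv, map_mul, charPow_add hχ, charPow_neg hχ, MulChar.mul_apply,
      MulChar.inv_apply_eq_inv', map_one]
    have u1 := fun s ↦ hu s y h1
    have u2 := fun s ↦ hu s z h3
    have u3 := fun s ↦ hu s _ h6
    have u4 := fun s ↦ hu s _ hz1
    have u5 := fun s ↦ hu s _ h7
    field_simp [u1, u2, u3, u4, u5]

omit [NeZero k] in
lemma fullTriple_swap {q : ℂ} {ε g : ZMod k → ℂ} (h : GaussSystem q ε g) {x y z : ZMod k}
    (hz : x + y + z = 0) : fullTriple q ε g x y z = fullTriple q ε g y x z := by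
  have ez : ε z = ε x * ε y := by
    rw [← h.eps_add, ← h.eps_neg, eq_neg_of_add_eq_zero_left hz]
  have hx := h.eps_sq x
  have hy := h.eps_sq y
  have e0 := h.eps_zero
  simp only [fullTriple, triple_swap x]
  by_cases x0 : x = 0 <;> by_cases y0 : y = 0 <;> by_cases z0 : z = 0 <;>
    simp only [x0, y0, z0, if_true, if_false, true_and, false_and, and_false] at * <;> grind

omit [NeZero k] in
lemma fullTriple_swap_right {q : ℂ} {ε g : ZMod k → ℂ} (h : GaussSystem q ε g) {x y z : ZMod k}
    (hz : x + y + z = 0) : fullTriple q ε g x y z = fullTriple q ε g x z y := by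
  have ez : ε z = ε x * ε y := by
    rw [← h.eps_add, ← h.eps_neg, eq_neg_of_add_eq_zero_left hz]
  have hx := h.eps_sq x
  have hy := h.eps_sq y
  have e0 := h.eps_zero
  simp only [fullTriple, triple_swap_right x y]
  by_cases x0 : x = 0 <;> by_cases y0 : y = 0 <;> by_cases z0 : z = 0 <;>
    simp only [x0, y0, z0, if_true, if_false, true_and, false_and, and_false] at * <;> grind

lemma pentagonSum_side_eq (hχ : orderOf χ = k) (hneg : χ (-1) = -1) (a b c d : ZMod k) :
    pentagonSum χ (a, b, c, d, 0) = onEdges (degenerateValue (Fintype.card F : ℂ) (charSign χ)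
      (charGauss χ)) (a, b, c, d, 0) := by
  have h := gaussSystem hχ hneg
  have h1 := degenerateValue_of_side h (x := c) (y := -(a + c)) (z := a) (x' := d)
    (y' := -(b + d)) (z' := b) (p := c + d) (r := -(a + b + c + d)) (s := a + b)
    (by ring) (by ring) rfl (by ring) rfl
  simp only [onEdges, add_zero]
  rw [← h1, fullTriple_swap_right h (x := c + d) (y := -(a + b + c + d)) (by ring), fullTriple_swap h (x := c + d) (y := a + b) (by ring),
    ← charSign_mul_jacobiSum hχ hneg (by ring), ← charSign_mul_jacobiSum hχ hneg (by ring),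
    ← charSign_mul_jacobiSum hχ hneg (by ring), pentagonSum_side hχ]
  simp only [h.eps_add, h.eps_neg]
  have ha := h.eps_sq a
  have hb := h.eps_sq b
  have hc := h.eps_sq c
  have hd := h.eps_sq d
  grind

lemma pentagonSum_diagonal_eq (hχ : orderOf χ = k) (hneg : χ (-1) = -1) (b c d e : ZMod k) :
    pentagonSum χ (0, b, c, d, e) = onEdges (degenerateValue (Fintype.card F : ℂ) (charSign χ)
      (charGauss χ)) (0, b, c, d, e) := by
  have h := gaussSystem hχ hneg
  have h1 := degenerateValue_of_diagonal h (x := c) (y := e) (z := -(c + e))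
    (x' := -(b + c + d + e)) (y' := b) (z' := c + d + e) (p := -(b + d + e)) (r := b + e) (s := d)
    (by ring) (by ring) (by ring) (by ring) (by ring)
  simp only [onEdges, zero_add]
  rw [← h1, ← charSign_mul_jacobiSum hχ hneg (by ring), ← charSign_mul_jacobiSum hχ hneg (by ring),
    ← charSign_mul_jacobiSum hχ hneg (by ring), pentagonSum_diagonal hχ]
  simp only [h.eps_add, h.eps_neg]
  have hb := h.eps_sq b
  have hc := h.eps_sq c
  have hd := h.eps_sq d
  have he := h.eps_sq e
  grind

lemma pentagonSum_eq_degenerateValue_of_apply (hχ : orderOf χ = k) {t : PentagonWeight k}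
    (h : pentagonSum χ (pentagonRotate k t) = onEdges (degenerateValue (Fintype.card F : ℂ)
      (charSign χ) (charGauss χ)) (pentagonRotate k t)) :
    pentagonSum χ t = onEdges (degenerateValue (Fintype.card F : ℂ) (charSign χ)
      (charGauss χ)) t := by
  rwa [pentagonSum_rotate hχ, onEdges_degenerateValue_rotate] at h

/-- A pentagon sum with a vanishing edge weight is evaluated by Gauss sums. -/
lemma pentagonSum_eq_degenerateValue (hχ : orderOf χ = k) (hneg : χ (-1) = -1)
    {a b c d e : ZMod k} (h : ¬(a ≠ 0 ∧ b ≠ 0 ∧ c ≠ 0 ∧ d ≠ 0 ∧ e ≠ 0 ∧ c + d + e ≠ 0 ∧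
      a + b + c + d + e ≠ 0 ∧ a + c + e ≠ 0 ∧ a + b + e ≠ 0 ∧ b + d + e ≠ 0)) :
    pentagonSum χ (a, b, c, d, e) = onEdges (degenerateValue (Fintype.card F : ℂ) (charSign χ)
      (charGauss χ)) (a, b, c, d, e) := by
  have h1 : ∀ t : PentagonWeight k, t.1 = 0 ∨ t.2.2.2.2 = 0 → pentagonSum χ t =
      onEdges (degenerateValue (Fintype.card F : ℂ) (charSign χ) (charGauss χ)) t := by
    rintro ⟨a, b, c, d, e⟩ (rfl | rfl)
    · exact pentagonSum_diagonal_eq hχ hneg b c d e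
    · exact pentagonSum_side_eq hχ hneg a b c d
  have h2 : ∀ t : PentagonWeight k, (pentagonRotate k t).1 = 0 ∨ (pentagonRotate k t).2.2.2.2 = 0 →
      pentagonSum χ t = onEdges (degenerateValue (Fintype.card F : ℂ) (charSign χ)
        (charGauss χ)) t := fun t ht ↦
    pentagonSum_eq_degenerateValue_of_apply hχ (h1 _ ht)
  have h3 : ∀ t : PentagonWeight k, (pentagonRotate k (pentagonRotate k t)).1 = 0 ∨
      (pentagonRotate k (pentagonRotate k t)).2.2.2.2 = 0 →
      pentagonSum χ t = onEdges (degenerateValue (Fintype.card F : ℂ) (charSign χ)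
        (charGauss χ)) t := fun t ht ↦
    pentagonSum_eq_degenerateValue_of_apply hχ (h2 _ ht)
  have h4 : ∀ t : PentagonWeight k,
      (pentagonRotate k (pentagonRotate k (pentagonRotate k t))).1 = 0 ∨
      (pentagonRotate k (pentagonRotate k (pentagonRotate k t))).2.2.2.2 = 0 →
      pentagonSum χ t = onEdges (degenerateValue (Fintype.card F : ℂ) (charSign χ)
        (charGauss χ)) t := fun t ht ↦
    pentagonSum_eq_degenerateValue_of_apply hχ (h3 _ ht)
  have h5 : ∀ t : PentagonWeight k,
      (pentagonRotate k (pentagonRotate k (pentagonRotate k (pentagonRotate k t)))).1 = 0 ∨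
      (pentagonRotate k (pentagonRotate k (pentagonRotate k (pentagonRotate k t)))).2.2.2.2 = 0 →
      pentagonSum χ t = onEdges (degenerateValue (Fintype.card F : ℂ) (charSign χ)
        (charGauss χ)) t := fun t ht ↦
    pentagonSum_eq_degenerateValue_of_apply hχ (h4 _ ht)
  -- Each of the ten edges is moved by at most four rotations to the diagonal `a` (`.inl`) or the
  -- side `e` (`.inr`).
  by_contra hn
  refine h ⟨?_, ?_, ?_, ?_, ?_, ?_, ?_, ?_, ?_, ?_⟩ <;> intro h0 <;> apply hn
  · exact h1 _ (.inl h0)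
  · exact h3 _ (.inl (by simp only [pentagonRotate, Equiv.coe_fn_mk]; linear_combination h0))
  · exact h4 _ (.inl (by simp only [pentagonRotate, Equiv.coe_fn_mk]; linear_combination h0))
  · exact h5 _ (.inr (by simp only [pentagonRotate, Equiv.coe_fn_mk]; linear_combination h0))
  · exact h1 _ (.inr h0)
  · exact h3 _ (.inr (by simp only [pentagonRotate, Equiv.coe_fn_mk]; linear_combination h0))
  · exact h4 _ (.inr (by simp only [pentagonRotate, Equiv.coe_fn_mk]; linear_combination -h0))
  · exact h2 _ (.inr (by simp only [pentagonRotate, Equiv.coe_fn_mk]; linear_combination -h0))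
  · exact h2 _ (.inl (by simp only [pentagonRotate, Equiv.coe_fn_mk]; linear_combination h0))
  · exact h5 _ (.inl (by simp only [pentagonRotate, Equiv.coe_fn_mk]; linear_combination -h0))

omit [NeZero k] in
-- Every summand requires some edge to vanish; this permits summing the closed form over all
-- weights.
lemma degenerateValue_eq_zero {q : ℂ} {ε g : ZMod k → ℂ} {a b c d e : ZMod k}
    (h : a ≠ 0 ∧ b ≠ 0 ∧ c ≠ 0 ∧ d ≠ 0 ∧ e ≠ 0 ∧ c + d + e ≠ 0 ∧
      a + b + c + d + e ≠ 0 ∧ a + c + e ≠ 0 ∧ a + b + e ≠ 0 ∧ b + d + e ≠ 0) :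
    onEdges (degenerateValue q ε g) (a, b, c, d, e) = 0 := by
  obtain ⟨h1, h2, h3, h4, h5, h6, h7, h8, h9, h10⟩ := h
  simp only [onEdges, degenerateValue, degenerateTerm, neg_eq_zero, h1, h2, h3, h4, h5, h6, h7, h8,
    h9, h10, if_false, and_false, add_zero, sub_zero]

/-- The total of all pentagon sums, split by degeneracy. -/
lemma sum_pentagonSum (hχ : orderOf χ = k) (hneg : χ (-1) = -1) :
    ∑ t : PentagonWeight k, pentagonSum χ t =
      ∑ a : ZMod k, ∑ b : ZMod k, ∑ c : ZMod k, ∑ d : ZMod k, ∑ e : ZMod k,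
        (if a ≠ 0 ∧ b ≠ 0 ∧ c ≠ 0 ∧ d ≠ 0 ∧ e ≠ 0 ∧ c + d + e ≠ 0 ∧
          a + b + c + d + e ≠ 0 ∧ a + c + e ≠ 0 ∧ a + b + e ≠ 0 ∧ b + d + e ≠ 0
          then pentagonSum χ (a, b, c, d, e) else 0) +
      ∑ t : PentagonWeight k, onEdges (degenerateValue (Fintype.card F : ℂ) (charSign χ)
        (charGauss χ)) t := by
  simp only [Fintype.sum_prod_type, ← Finset.sum_add_distrib]
  refine Finset.sum_congr rfl fun a _ ↦ Finset.sum_congr rfl fun b _ ↦ Finset.sum_congr rfl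
    fun c _ ↦ Finset.sum_congr rfl fun d _ ↦ Finset.sum_congr rfl fun e _ ↦ ?_
  split_ifs with h
  · rw [degenerateValue_eq_zero h, add_zero]
  · rw [pentagonSum_eq_degenerateValue hχ hneg h, zero_add]

end Characters

/-! ### Greene's function at 1 as a pentagon sum -/

section Greene

variable {F : Type*} [Field F] [Fintype F]

lemma sum_mulChar_apply [DecidableEq F] (u : F) :
    ∑ η : MulChar F ℂ, η u = if u = 1 then (Fintype.card F : ℂ) - 1 else 0 := by
  split_ifs with h
  · have h1 := MulChar.card_eq_card_units_of_hasEnoughRootsOfUnity F ℂ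
    have h2 : (Nat.card Fˣ : ℂ) = Fintype.card F - 1 := by
      rw [Nat.card_eq_fintype_card, Fintype.card_units, Nat.cast_sub Fintype.card_pos, Nat.cast_one]
    simp only [h, map_one, Finset.sum_const, nsmul_eq_mul, mul_one, Finset.card_univ]
    rw [← h2, ← h1, Nat.card_eq_fintype_card]
  · obtain ⟨χ, hχ⟩ := MulChar.exists_apply_ne_one_of_hasEnoughRootsOfUnity F ℂ h
    refine eq_zero_of_mul_eq_self_left hχ ?_
    simp only [Finset.mul_sum, ← MulChar.mul_apply]
    exact Fintype.sum_bijective _ (Group.mulLeft_bijective χ) _ _ fun χ' ↦ rfl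

/-- Clearing denominators makes the condition linear in x, with the displayed solution. -/
lemma sum_apply_ite_eq_one (A : MulChar F ℂ) [DecidableEq F] {y z : F} (hy : y ≠ 0) (hy' : 1 - y ≠ 0)
    (hz : z ≠ 0) (hz' : 1 - z ≠ 0) :
    ∑ x, A x * (if -(x * (1 - x)⁻¹ * (y * (1 - y)⁻¹) * (z * (1 - z)⁻¹)) = 1 then 1 else 0) =
      A ((1 - y) * (1 - z) * (1 - y - z)⁻¹) := by
  have h : ∀ x, -(x * (1 - x)⁻¹ * (y * (1 - y)⁻¹) * (z * (1 - z)⁻¹)) = 1 ↔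
      x * (1 - y - z) = (1 - y) * (1 - z) := fun x ↦ by
    by_cases hx : 1 - x = 0
    · obtain rfl : x = 1 := by linear_combination -hx
      simp only [sub_self, inv_zero, mul_zero, zero_mul, neg_zero, zero_ne_one, false_iff]
      intro h
      exact mul_ne_zero hy hz (by linear_combination -h)
    · rw [← sub_eq_zero, ← sub_eq_zero (a := x * _)]
      have : -(x * (1 - x)⁻¹ * (y * (1 - y)⁻¹) * (z * (1 - z)⁻¹)) - 1 =
        (x * (1 - y - z) - (1 - y) * (1 - z)) * ((1 - x) * (1 - y) * (1 - z))⁻¹ := by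
        field_simp
        ring
      rw [this, mul_eq_zero, or_iff_left]
      exact inv_ne_zero (mul_ne_zero (mul_ne_zero hx hy') hz')
  simp only [h, mul_ite, mul_one, mul_zero]
  -- Here no x satisfies the condition, and the right side is 0 too, since 0⁻¹ = 0 and characters
  -- vanish at 0.
  by_cases h0 : 1 - y - z = 0
  · simp [h0, hy', hz', MulChar.map_zero, eq_comm (a := (0 : F))]
  · simp only [← eq_div_iff h0, ← div_eq_mul_inv, Finset.sum_ite_eq', Finset.mem_univ, if_true]

/-- Expanding the binomials gives a triple sum over x, y, z. Orthogonality in the summed character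
imposes one relation, which eliminates x; of the three factors η(-1), two cancel and the third puts
the minus sign into that relation. -/
lemma sq_mul_greeneHyp (A₀ A₁ A₂ B₁ B₂ : MulChar F ℂ) :
    (Fintype.card F : ℂ) ^ 2 * greeneHyp A₀ ![A₁, A₂] ![B₁, B₂] 1 = B₁ (-1) * B₂ (-1) *
      ∑ y, ∑ z, A₁ y * B₁⁻¹ (1 - y) * (A₂ z * B₂⁻¹ (1 - z)) *
        A₀ ((1 - y) * (1 - z) * (1 - y - z)⁻¹) := by
  classical
  have hq : (Fintype.card F : ℂ) ≠ 0 := Nat.cast_ne_zero.mpr Fintype.card_ne_zero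
  have hq1 : (Fintype.card F : ℂ) - 1 ≠ 0 := by
    rw [sub_ne_zero]
    exact_mod_cast Fintype.one_lt_card.ne'
  have key : ∀ η : MulChar F ℂ, (Fintype.card F : ℂ) ^ 3 * (greeneBinom (A₀ * η) η *
      (greeneBinom (A₁ * η) (B₁ * η) * greeneBinom (A₂ * η) (B₂ * η))) =
      B₁ (-1) * B₂ (-1) * ∑ y, ∑ z, ∑ x, A₁ y * B₁⁻¹ (1 - y) * (A₂ z * B₂⁻¹ (1 - z)) *
        (A₀ x * η (-(x * (1 - x)⁻¹ * (y * (1 - y)⁻¹) * (z * (1 - z)⁻¹)))) := fun η ↦ by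
    have h1 : η (-1) * η (-1) = 1 := by rw [← map_mul]; simp
    have h2 : ∀ x, η (-x) = η (-1) * η x := fun x ↦ by rw [← map_mul, neg_one_mul]
    simp only [greeneBinom, jacobiSum, mul_inv, MulChar.mul_apply, MulChar.inv_apply' η]
    calc _ = η (-1) * (η (-1) * η (-1)) * B₁ (-1) * B₂ (-1) * ((∑ x, A₀ x * η x * η (1 - x)⁻¹) *
          ((∑ y, A₁ y * η y * (B₁⁻¹ (1 - y) * η (1 - y)⁻¹)) *
          (∑ z, A₂ z * η z * (B₂⁻¹ (1 - z) * η (1 - z)⁻¹)))) := by field_simp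
      _ = _ := by
        rw [h1, Finset.sum_mul_sum, Finset.mul_sum]
        simp only [Finset.mul_sum, Finset.sum_mul]
        refine Finset.sum_congr rfl fun y _ ↦ Finset.sum_congr rfl fun z _ ↦
          Finset.sum_congr rfl fun x _ ↦ ?_
        rw [h2 (_ * _)]
        simp only [map_mul]
        ring
  have h3 : (Fintype.card F : ℂ) ^ 2 * greeneHyp A₀ ![A₁, A₂] ![B₁, B₂] 1 =
      1 / ((Fintype.card F : ℂ) - 1) * ∑ η : MulChar F ℂ, (Fintype.card F : ℂ) ^ 3 *
        (greeneBinom (A₀ * η) η *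
        (greeneBinom (A₁ * η) (B₁ * η) * greeneBinom (A₂ * η) (B₂ * η))) := by
    simp only [greeneHyp, Fin.prod_univ_two, Matrix.cons_val_zero, Matrix.cons_val_one, map_one,
      mul_one, ← Finset.mul_sum]
    ring
  simp only [h3, key]
  rw [← Finset.mul_sum, Finset.sum_comm, mul_left_comm, Finset.mul_sum]
  refine congrArg _ (Finset.sum_congr rfl fun y _ ↦ ?_)
  rw [Finset.sum_comm, Finset.mul_sum]
  refine Finset.sum_congr rfl fun z _ ↦ ?_
  rw [Finset.sum_comm]
  simp only [← Finset.mul_sum, sum_mulChar_apply]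
  by_cases hy : y = 0
  · simp [hy, MulChar.map_zero]
  by_cases hz : z = 0
  · simp [hz, MulChar.map_zero]
  by_cases hy' : 1 - y = 0
  · simp [hy', MulChar.map_zero]
  by_cases hz' : 1 - z = 0
  · simp [hz', MulChar.map_zero]
  rw [← sum_apply_ite_eq_one A₀ hy hy' hz hz', mul_left_comm]
  refine congrArg _ ?_
  rw [Finset.mul_sum]
  refine Finset.sum_congr rfl fun x _ ↦ ?_
  split_ifs
  · field_simp
  · simp

variable {k : ℕ} [NeZero k] {χ : MulChar F ℂ}

/-- Replacing z by 1 - z turns 1 - y - z into z - y. The sign in `hypVec` is exactly what makes all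
values at -1 cancel. -/
lemma sq_mul_hypVec (hχ : orderOf χ = k) (hneg : χ (-1) = -1) (t : Fin 5 → ZMod k) :
    (Fintype.card F : ℂ) ^ 2 * hypVec χ t 1 =
      pentagonSum χ (t 1, t 0 - t 4, t 0 - t 3, t 2, -t 0) := by
  have hS := gaussSystem hχ hneg
  have h2 := hS.eps_sq (t 2)
  have h3 := hS.eps_sq (t 3)
  have h4 := hS.eps_sq (t 4)
  rw [hypVec, mul_left_comm, sq_mul_greeneHyp, pow_add, ← charSign_eq hneg, ← charSign_eq hneg]
  simp only [← charPow.eq_1, ← charSign.eq_1, pentagonSum, Finset.mul_sum]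
  refine Finset.sum_congr rfl fun y _ ↦ ?_
  rw [← Equiv.sum_comp (Equiv.subLeft (1 : F))]
  refine Finset.sum_congr rfl fun z _ ↦ ?_
  have e1 : 1 - y - (1 - z) = z - y := by ring
  have e2 : ∀ (s : ZMod k) (x y : F), charPow χ s (x - y)⁻¹ =
      charSign χ s * charPow χ s (y - x)⁻¹ := fun s x y ↦ by
    rw [← charPow_neg_apply, ← inv_neg, neg_sub]
  simp only [Equiv.subLeft_apply, sub_sub_cancel, e1, map_mul, charPow_sub hχ, charPow_neg hχ,
    MulChar.mul_apply, MulChar.inv_apply']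
  rw [charPow_sub_comm _ 1 y, charPow_sub_comm _ 1 z, e2 _ 1 y, e2 _ z y]
  have h0 := hS.eps_sq (t 0)
  grind

end Greene

/-! ### The sums ℝ, 𝕊, 𝕊⁻ in Gauss-sum form -/

section JacobiSums

lemma sum_Icc_eq_sum_zmod {k : ℕ} [NeZero k] (f : ℕ → ℂ) :
    ∑ n ∈ Finset.Icc 1 (k - 1), f n = ∑ s : ZMod k, if s ≠ 0 then f s.val else 0 := by
  rw [← Finset.sum_filter]
  have hk := NeZero.pos k
  have hval : ∀ n ∈ Finset.Icc 1 (k - 1), (n : ZMod k).val = n := fun n hn ↦ by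
    rw [Finset.mem_Icc] at hn
    exact ZMod.val_cast_of_lt (by omega)
  refine Finset.sum_bij' (fun n _ ↦ (n : ZMod k)) (fun s _ ↦ s.val) ?_ ?_ ?_ ?_ ?_
  · intro n hn
    have h := hval n hn
    rw [Finset.mem_Icc] at hn
    simp only [Finset.mem_filter, Finset.mem_univ, true_and]
    intro h0
    rw [h0, ZMod.val_zero] at h
    omega
  · intro s hs
    have h1 := (ZMod.val_ne_zero s).mpr (Finset.mem_filter.mp hs).2
    have h2 := ZMod.val_lt s
    rw [Finset.mem_Icc]
    omega
  · exact hval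
  · intro s _
    exact ZMod.natCast_zmod_val s
  · intro n hn
    rw [hval n hn]

variable {F : Type*} [Field F] [Fintype F] {k : ℕ} [NeZero k] {χ : MulChar F ℂ}

omit [Fintype F] in
lemma inv_pow_val (hχ : orderOf χ = k) (s : ZMod k) : χ⁻¹ ^ s.val = charPow χ (-s) := by
  rw [charPow_neg hχ, charPow, inv_pow]

lemma jacobiSum_charPow (hχ : orderOf χ = k) (hneg : χ (-1) = -1) {s t : ZMod k} (hs : s ≠ 0)
    (ht : t ≠ 0) (hst : s + t ≠ 0) : jacobiSum (charPow χ s) (charPow χ t) =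
      charSign χ (s + t) * triple (Fintype.card F : ℂ) (charGauss χ) s t (-(s + t)) := by
  have h := gaussSystem hχ hneg
  have h1 := charSign_mul_jacobiSum hχ hneg (x := s) (y := t) (z := -(s + t)) (by ring)
  have h2 := h.eps_sq (s + t)
  simp only [fullTriple, hs, ht, neg_eq_zero, hst, if_false, false_and, sub_zero, add_zero,
    h.eps_neg] at h1
  rw [← h1]
  linear_combination -jacobiSum (charPow χ s) (charPow χ t) * h2

lemma dvd_val_add_iff (s t : ZMod k) :
    (k : ℤ) ∣ (s.val : ℤ) + t.val ↔ s + t = 0 := by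
  rw [← ZMod.intCast_zmod_eq_zero_iff_dvd]
  simp

lemma dvd_val_sub_iff (s t : ZMod k) : (k : ℤ) ∣ (s.val : ℤ) - t.val ↔ s - t = 0 := by
  rw [← ZMod.intCast_zmod_eq_zero_iff_dvd]
  simp

lemma jacR_eq_tripleSum (hχ : orderOf χ = k) (hneg : χ (-1) = -1) :
    jacR k χ = tripleSum k (Fintype.card F : ℂ) (charSign χ) (charGauss χ) := by
  have h := gaussSystem hχ hneg
  have h1 : jacR k χ = ∑ s : ZMod k, ∑ t : ZMod k, charSign χ (s + t) *
      triple (Fintype.card F : ℂ) (charGauss χ) s t (-(s + t)) := by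
    simp only [jacR, sum_Icc_eq_sum_zmod, dvd_val_add_iff, ← charPow.eq_1]
    refine Finset.sum_congr rfl fun s _ ↦ ?_
    by_cases hs : s = 0
    · simp [hs, triple]
    rw [if_pos hs]
    refine Finset.sum_congr rfl fun t _ ↦ ?_
    by_cases ht : t = 0
    · simp [ht, triple]
    rw [if_pos ht]
    split_ifs with hst
    · simp [triple, hst]
    · exact jacobiSum_charPow hχ hneg hs ht hst
  rw [h1, tripleSum]
  conv_rhs => rw [Finset.sum_comm]
  refine Finset.sum_congr rfl fun t _ ↦ ?_
  -- The symmetry of `triple` in s, t, -(s+t) moves the sign from s + t to a single entry.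
  rw [sum_reflect (-t)]
  refine Finset.sum_congr rfl fun s _ ↦ ?_
  rw [show t + (-t - s) = -s by ring, h.eps_neg, neg_neg, show -t - s = -(s + t) by ring,
    triple_swap_right, triple_swap]

/-- Only v + t ≠ 0 has to be imposed by `triplePair`; the other exclusions hold because `triple`
vanishes at a zero entry. -/
lemma jacobiSum_mul_jacobiSum (hχ : orderOf χ = k) (hneg : χ (-1) = -1) (s t v : ZMod k) :
    (if s ≠ 0 then if t ≠ 0 then if v ≠ 0 then if ¬ s + t = 0 ∧ ¬ v + t = 0 ∧ ¬ v - s = 0 then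
      jacobiSum (charPow χ s) (charPow χ t) * jacobiSum (charPow χ (-s)) (charPow χ v) else 0
      else 0 else 0 else 0) =
      charSign χ (t + v) * triplePair (Fintype.card F : ℂ) (charGauss χ) s t v := by
  have h := gaussSystem hχ hneg
  by_cases hs : s = 0
  · simp [hs, triplePair, triple]
  by_cases ht : t = 0
  · simp [ht, triplePair, triple]
  by_cases hv : v = 0
  · simp [hv, triplePair, triple]
  rw [if_pos hs, if_pos ht, if_pos hv, triplePair]
  split_ifs with h1 h2 h2
  · exact absurd h2 h1.2.1
  · rw [jacobiSum_charPow hχ hneg hs ht h1.1,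
      jacobiSum_charPow hχ hneg (neg_ne_zero.mpr hs) hv (by rw [neg_add_eq_sub]; exact h1.2.2),
      show -(-s + v) = s - v by ring]
    simp only [h.eps_add, h.eps_neg]
    linear_combination charSign χ t * charSign χ v *
      triple (Fintype.card F : ℂ) (charGauss χ) s t (-(s + t)) *
      triple (Fintype.card F : ℂ) (charGauss χ) (-s) v (s - v) * h.eps_sq s
  · rw [mul_zero]
  · simp only [h2, not_false_eq_true, true_and, not_and_or, not_not] at h1
    rcases h1 with h1 | h1
    · simp [triple, h1]
    · simp [triple, sub_eq_zero.mp h1]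

lemma jacS_eq (hχ : orderOf χ = k) (hneg : χ (-1) = -1) :
    jacS k χ = ∑ s : ZMod k, ∑ t : ZMod k, ∑ v : ZMod k, charSign χ (t + v) *
      triplePair (Fintype.card F : ℂ) (charGauss χ) s t v := by
  simp only [jacS, sum_Icc_eq_sum_zmod, dvd_val_add_iff, dvd_val_sub_iff, inv_pow_val hχ,
    ← charPow.eq_1, ← jacobiSum_mul_jacobiSum hχ hneg]
  refine Finset.sum_congr rfl fun s _ ↦ ?_
  by_cases hs : s = 0
  · simp [hs]
  simp only [if_pos hs]
  refine Finset.sum_congr rfl fun t _ ↦ ?_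
  by_cases ht : t = 0
  · simp [ht]
  simp only [if_pos ht]

lemma jacSMinus_eq (hχ : orderOf χ = k) (hneg : χ (-1) = -1) :
    jacSMinus k χ = ∑ s : ZMod k, ∑ t : ZMod k, ∑ v : ZMod k, charSign χ (s + v) *
      triplePair (Fintype.card F : ℂ) (charGauss χ) s t v := by
  have h := gaussSystem hχ hneg
  have h1 : ∀ s t v : ZMod k, charSign χ (s + v) *
      triplePair (Fintype.card F : ℂ) (charGauss χ) s t v = charSign χ (s + t) *
      (charSign χ (t + v) * triplePair (Fintype.card F : ℂ) (charGauss χ) s t v) :=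
    fun s t v ↦ by
      simp only [h.eps_add]
      linear_combination -charSign χ s * charSign χ v *
        triplePair (Fintype.card F : ℂ) (charGauss χ) s t v * h.eps_sq t
  simp only [jacSMinus, sum_Icc_eq_sum_zmod, dvd_val_add_iff, dvd_val_sub_iff, inv_pow_val hχ,
    ← charPow.eq_1, pow_add, ← charSign_eq hneg]
  simp only [h1]
  simp only [← h.eps_add, ← jacobiSum_mul_jacobiSum hχ hneg]
  refine Finset.sum_congr rfl fun s _ ↦ ?_
  by_cases hs : s = 0
  · simp [hs]
  simp only [if_pos hs]
  refine Finset.sum_congr rfl fun t _ ↦ ?_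
  by_cases ht : t = 0
  · simp [ht]
  simp only [if_pos ht, mul_ite, mul_zero, mul_assoc]

/-- The free pentagon coordinates of a parameter vector of `hypVec`. -/
def hypWeight (k : ℕ) : (Fin 5 → ZMod k) ≃ PentagonWeight k where
  toFun t := (t 1, t 0 - t 4, t 0 - t 3, t 2, -t 0)
  invFun | (a, b, c, d, e) => ![-e, a, d, -e - c, -e - b]
  left_inv t := by ext i; fin_cases i <;> simp
  right_inv := by rintro ⟨a, b, c, d, e⟩; ext <;> simp

/-- In pentagon coordinates the ten inequalities defining X_k say that all ten edge weights are
nonzero. -/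
lemma sq_mul_sum_hypVec (hχ : orderOf χ = k) (hneg : χ (-1) = -1) :
    (Fintype.card F : ℂ) ^ 2 * ∑ t ∈ nondegenerate k, hypVec χ t 1 =
      ∑ a : ZMod k, ∑ b : ZMod k, ∑ c : ZMod k, ∑ d : ZMod k, ∑ e : ZMod k,
        (if a ≠ 0 ∧ b ≠ 0 ∧ c ≠ 0 ∧ d ≠ 0 ∧ e ≠ 0 ∧ c + d + e ≠ 0 ∧
          a + b + c + d + e ≠ 0 ∧ a + c + e ≠ 0 ∧ a + b + e ≠ 0 ∧ b + d + e ≠ 0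
          then pentagonSum χ (a, b, c, d, e) else 0) := by
  rw [Finset.mul_sum, nondegenerate, Finset.sum_filter]
  simp only [← Finset.sum_product', Finset.univ_product_univ]
  refine Fintype.sum_equiv (hypWeight k) _ _ fun t ↦ ?_
  simp only [hypWeight, Equiv.coe_fn_mk, sq_mul_hypVec hχ hneg]
  congr 1
  refine propext ⟨?_, ?_⟩ <;> grind

end JacobiSums

/-! ### Transitive subtournaments as increasing sequences -/

section Tournaments

lemma exists_enumeration {V : Type*} {m : ℕ} {G : Digraph V} {S : Finset V} {T : Digraph V}
    (hS : S.card = m) (hT : IsTransitiveSubtournament G S T) :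
    ∃ v : Fin m → V, (∀ i j, i < j → T.Adj (v i) (v j)) ∧ ∀ a, a ∈ S ↔ ∃ i, v i = a := by
  classical
  have : IsStrictTotalOrder S (fun a b ↦ T.Adj a b) :=
    { irrefl := fun a ↦ hT.irrefl a
      trans := fun a b c ↦ hT.trans a b c
      trichotomous := fun a b h1 h2 ↦ by
        by_contra hne
        rcases hT.tournament a a.2 b b.2 (fun h ↦ hne (Subtype.ext h)) with h | h
        · exact h1 h.1
        · exact h2 h.1 }
  let _ : LinearOrder S := linearOrderOfSTO (fun a b : S ↦ T.Adj a b)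
  let f := Fintype.orderIsoFinOfCardEq S (by rw [Fintype.card_coe, hS] : Fintype.card S = m)
  refine ⟨fun i ↦ f i, fun i j h ↦ f.strictMono h, fun a ↦ ⟨fun ha ↦ ⟨f.symm ⟨a, ha⟩, by simp⟩, ?_⟩⟩
  rintro ⟨i, rfl⟩
  exact (f i).2

/-- In an asymmetric digraph, a transitive subtournament is an increasing sequence of vertices. -/
lemma numTransitiveSubtournaments_eq {V : Type*} (m : ℕ) {G : Digraph V}
    (hG : ∀ a b, G.Adj a b → ¬ G.Adj b a) :
    numTransitiveSubtournaments m G =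
      {v : Fin m → V | ∀ i j, i < j → G.Adj (v i) (v j)}.ncard := by
  classical
  have hirr : ∀ a, ¬ G.Adj a a := fun a h ↦ hG a a h h
  let f : (Fin m → V) → Finset V × Digraph V := fun v ↦
    (Finset.univ.image v, ⟨fun a b ↦ (∃ i, v i = a) ∧ (∃ i, v i = b) ∧ G.Adj a b⟩)
  have hlt : ∀ v : Fin m → V, (∀ i j, i < j → G.Adj (v i) (v j)) → ∀ i j,
      G.Adj (v i) (v j) ↔ i < j := fun v hv i j ↦ by
    refine ⟨fun h ↦ ?_, hv i j⟩
    rcases lt_trichotomy i j with hij | rfl | hij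
    · exact hij
    · exact absurd h (hirr _)
    · exact absurd h (hG _ _ (hv _ _ hij))
  have hvinj : ∀ v : Fin m → V, (∀ i j, i < j → G.Adj (v i) (v j)) → Function.Injective v :=
    fun v hv i j hij ↦ by
      by_contra hne
      rcases lt_or_gt_of_ne hne with h | h
      · exact hirr _ (hij ▸ hv _ _ h)
      · exact hirr _ (hij ▸ hv _ _ h)
  -- The position of a vertex is its number of in-neighbours in the set, so the set determines the
  -- sequence.
  have hcount : ∀ v : Fin m → V, (∀ i j, i < j → G.Adj (v i) (v j)) → ∀ j,
      {a ∈ Finset.univ.image v | G.Adj a (v j)}.card = j := fun v hv j ↦ by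
    rw [Finset.filter_image, Finset.card_image_of_injective _ (hvinj v hv)]
    simp only [hlt v hv]
    rw [Finset.filter_gt_eq_Iio, Fin.card_Iio]
  have hf : Set.InjOn f {v : Fin m → V | ∀ i j, i < j → G.Adj (v i) (v j)} := by
    intro v hv w hw h
    have h1 : Finset.univ.image v = Finset.univ.image w := congrArg Prod.fst h
    funext i
    have h2 : v i ∈ Finset.univ.image w := h1 ▸ Finset.mem_image_of_mem v (Finset.mem_univ i)
    obtain ⟨j, -, hj⟩ := Finset.mem_image.mp h2
    have h3 := hcount v hv i
    rw [h1, ← hj, hcount w hw j] at h3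
    rw [← hj, Fin.ext h3]
  rw [numTransitiveSubtournaments, ← hf.ncard_image]
  congr 1
  ext ⟨S, T⟩
  constructor
  · rintro ⟨hS, hT⟩
    obtain ⟨v, hv, hmem⟩ := exists_enumeration hS hT
    refine ⟨v, fun i j hij ↦ (hT.sub _ _ (hv i j hij)).2.2, Prod.ext ?_ ?_⟩
    · ext a
      simp [f, hmem]
    · refine Digraph.ext (funext fun a ↦ funext fun b ↦ propext ?_)
      simp only [f, ← hmem]
      refine ⟨fun ⟨ha, hb, hab⟩ ↦ ?_, fun h ↦ hT.sub a b h⟩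
      have hne : a ≠ b := by rintro rfl; exact hirr _ hab
      rcases hT.tournament a ha b hb hne with h | h
      · exact h.1
      · exact absurd hab (hG _ _ (hT.sub _ _ h.1).2.2)
  · rintro ⟨v, hv, h⟩
    obtain ⟨rfl, rfl⟩ := Prod.ext_iff.mp h.symm
    refine ⟨?_, ?_, ?_, ?_, ?_⟩
    · simp only [f]
      rw [Finset.card_image_of_injective _ (hvinj v hv), Finset.card_univ, Fintype.card_fin]
    · rintro a b ⟨ha, hb, hab⟩
      simp [f, ha, hb, hab]
    · rintro a ⟨-, -, ha⟩
      exact hirr a ha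
    · rintro a ha b hb hab
      simp only [f, Finset.mem_image, Finset.mem_univ, true_and] at ha hb
      obtain ⟨i, rfl⟩ := ha
      obtain ⟨j, rfl⟩ := hb
      rcases lt_or_gt_of_ne (fun h ↦ hab (congrArg v h)) with h | h
      · exact .inl ⟨⟨⟨i, rfl⟩, ⟨j, rfl⟩, hv _ _ h⟩, fun h' ↦ hG _ _ (hv _ _ h) h'.2.2⟩
      · exact .inr ⟨⟨⟨j, rfl⟩, ⟨i, rfl⟩, hv _ _ h⟩, fun h' ↦ hG _ _ (hv _ _ h) h'.2.2⟩
    · rintro a b c ⟨⟨i, rfl⟩, ⟨j, rfl⟩, h1⟩ ⟨-, ⟨l, rfl⟩, h2⟩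
      rw [hlt v hv] at h1 h2
      exact ⟨⟨i, rfl⟩, ⟨l, rfl⟩, hv _ _ (h1.trans h2)⟩

end Tournaments

/-! ### Counting increasing quadruples by character sums -/

section Counting

variable {F : Type*} [Field F] [Fintype F] {k : ℕ} [NeZero k] {χ : MulChar F ℂ}

omit [NeZero k] in
-- Here (q-1)/2 is k/2 times an odd number, so k does not divide it. If χ(-1) were 1, then
-- u^((q-1)/2) = ±1 would give χ^((q-1)/2) = 1.
lemma apply_neg_one (hk_even : Even k) (hk : 0 < k) (hq : Fintype.card F ≡ k + 1 [MOD 2 * k])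
    (hχ : orderOf χ = k) : χ (-1) = -1 := by
  obtain ⟨r, rfl⟩ := hk_even
  obtain ⟨j, hj⟩ : ∃ j, Fintype.card F = 2 * (r * (2 * j + 1)) + 1 := by
    have h1 : r + r + 1 ≤ Fintype.card F := by
      by_contra hlt
      have h2 := Nat.ModEq.eq_of_lt_of_lt hq (by omega) (by omega)
      omega
    obtain ⟨j, hj⟩ := (Nat.modEq_iff_dvd' h1).mp hq.symm
    refine ⟨j, ?_⟩
    have : Fintype.card F = 2 * (r + r) * j + (r + r + 1) := by omega
    rw [this]
    ring
  have hsq : χ (-1) * χ (-1) = 1 := by rw [← map_mul]; simp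
  refine (mul_self_eq_one_iff.mp hsq).resolve_left fun h ↦ ?_
  have h1 : χ ^ (r * (2 * j + 1)) = 1 := by
    ext u
    rw [MulChar.pow_apply_coe, MulChar.one_apply_coe, ← map_pow]
    have h2 : ((u : F) ^ (r * (2 * j + 1))) * ((u : F) ^ (r * (2 * j + 1))) = 1 := by
      rw [← pow_add, ← two_mul]
      have := FiniteField.pow_card_sub_one_eq_one (u : F) u.ne_zero
      rwa [hj, Nat.add_sub_cancel] at this
    rcases mul_self_eq_one_iff.mp h2 with h3 | h3 <;> rw [h3]
    · exact map_one χ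
    · exact h
  rw [← orderOf_dvd_iff_pow_eq_one, hχ, ← two_mul, mul_comm 2] at h1
  have h2 := Nat.dvd_of_mul_dvd_mul_left (by omega) h1
  omega

/-- Being a `k`-th power residue, as a predicate on the field. -/
def IsPowerResidue {F : Type*} [Field F] (k : ℕ) (w : F) : Prop :=
  ∃ u ∈ powerResidues F k, (u : F) = w

open scoped Classical in
/-- The indicator function of the `k`-th power residues. -/
noncomputable def residueIndicator {F : Type*} [Field F] (k : ℕ) (w : F) : ℂ :=
  if IsPowerResidue k w then 1 else 0

omit [NeZero k] in
lemma apply_eq_one_iff (hχ : orderOf χ = k) (u : Fˣ) : χ u = 1 ↔ u ∈ powerResidues F k := by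
  constructor
  · intro h
    obtain ⟨g, hg⟩ := IsCyclic.exists_generator (α := Fˣ)
    obtain ⟨n, rfl⟩ := (Submonoid.mem_powers_iff _ _).mp (mem_powers_iff_mem_zpowers.mpr (hg u))
    have h1 : χ ^ n = 1 := by
      rw [MulChar.eq_iff hg, MulChar.pow_apply_coe, MulChar.one_apply_coe, ← map_pow, ← h,
        Units.val_pow_eq_pow_val]
    rw [← orderOf_dvd_iff_pow_eq_one, hχ] at h1
    obtain ⟨m, rfl⟩ := h1
    exact ⟨g ^ m, by rw [powMonoidHom_apply, ← pow_mul, mul_comm]⟩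
  · rintro ⟨v, rfl⟩
    rw [powMonoidHom_apply, Units.val_pow_eq_pow_val, map_pow, ← MulChar.pow_apply_coe, ← hχ,
      pow_orderOf_eq_one, MulChar.one_apply_coe]

/-- Orthogonality: off the residues, shifting s by 1 multiplies the sum by χ(w) ≠ 1. -/
lemma sum_charPow_apply (hk : 2 ≤ k) (hχ : orderOf χ = k) (w : F) :
    ∑ s : ZMod k, charPow χ s w = k * residueIndicator k w := by
  rw [residueIndicator]
  by_cases hw : w = 0
  · have : ¬ IsPowerResidue k w := fun ⟨u, _, hu⟩ ↦ u.ne_zero (hu.trans hw)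
    rw [if_neg this, hw]
    simp [MulChar.map_zero]
  obtain ⟨u, rfl⟩ := isUnit_iff_ne_zero.mpr hw
  have h1 : IsPowerResidue k (u : F) ↔ χ u = 1 := by
    rw [apply_eq_one_iff hχ, IsPowerResidue]
    exact ⟨fun ⟨v, hv, h⟩ ↦ Units.ext h ▸ hv, fun h ↦ ⟨u, h, rfl⟩⟩
  simp only [h1]
  split_ifs with h
  · have : ∀ s : ZMod k, charPow χ s u = 1 := fun s ↦ by
      rw [charPow, MulChar.pow_apply_coe, h, one_pow]
    simp [this]
  · have : Fact (1 < k) := ⟨hk⟩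
    have h2 := sum_shift (1 : ZMod k) (fun s ↦ charPow χ s (u : F))
    have h3 : charPow χ (1 : ZMod k) (u : F) = χ u := by
      rw [charPow, ZMod.val_one, pow_one]
    simp only [charPow_add hχ, MulChar.mul_apply, h3, ← Finset.sum_mul] at h2
    rw [mul_zero]
    refine eq_zero_of_mul_eq_self_right h h2.symm

lemma sum_residueIndicator (hk : 2 ≤ k) (hχ : orderOf χ = k) :
    k * ∑ w : F, residueIndicator k w = Fintype.card F - 1 := by
  classical
  rw [Finset.mul_sum]
  simp only [← sum_charPow_apply hk hχ]
  rw [Finset.sum_comm, Finset.sum_eq_single (0 : ZMod k)]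
  · rw [charPow_zero, MulChar.sum_one_eq_card_units, Fintype.card_units,
      Nat.cast_sub Fintype.card_pos, Nat.cast_one]
  · intro s _ hs
    exact MulChar.sum_eq_zero_of_ne_one fun h ↦ hs ((charPow_eq_one hχ).mp h)
  · simp

lemma sum_pentagonSum_eq (hk : 2 ≤ k) (hχ : orderOf χ = k) :
    ∑ t : PentagonWeight k, pentagonSum χ t = (k : ℂ) ^ 5 * ∑ y : F, ∑ z : F,
      residueIndicator k y * residueIndicator k z * residueIndicator k (y - 1) *
        residueIndicator k (z - 1) * residueIndicator k (y - z) := by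
  have h1 : ∀ y z : F, (k : ℂ) ^ 5 * (residueIndicator k y * residueIndicator k z *
      residueIndicator k (y - 1) * residueIndicator k (z - 1) * residueIndicator k (y - z)) =
      ∑ t : PentagonWeight k, charPow χ t.1 y * charPow χ t.2.1 z * charPow χ t.2.2.1 (y - 1) *
        charPow χ t.2.2.2.1 (z - 1) * charPow χ t.2.2.2.2 (y - z) := fun y z ↦ by
    simp only [Fintype.sum_prod_type, ← Finset.mul_sum, ← Finset.sum_mul, sum_charPow_apply hk hχ]
    ring
  simp only [Finset.mul_sum, h1]
  refine Eq.trans (?_ : _ = ∑ t : PentagonWeight k, ∑ y, ∑ z, charPow χ t.1 y *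
    charPow χ t.2.1 z * charPow χ t.2.2.1 (y - 1) * charPow χ t.2.2.2.1 (z - 1) *
    charPow χ t.2.2.2.2 (y - z)) ?_
  · rfl
  · rw [Finset.sum_comm]
    exact Finset.sum_congr rfl fun y _ ↦ Finset.sum_comm

omit [Fintype F] [NeZero k] in
lemma residueIndicator_mul {x : F} (h : IsPowerResidue k x) (w : F) :
    residueIndicator k (x * w) = residueIndicator k w := by
  obtain ⟨u, hu, rfl⟩ := h
  have : IsPowerResidue k (u * w) ↔ IsPowerResidue k w :=
    ⟨fun ⟨v, hv, h⟩ ↦ ⟨u⁻¹ * v, mul_mem (inv_mem hu) hv, by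
      rw [Units.val_mul, h, Units.inv_mul_cancel_left]⟩, fun ⟨v, hv, h⟩ ↦ ⟨u * v, mul_mem hu hv, by
      rw [Units.val_mul, h]⟩⟩
  classical exact if_congr this rfl rfl

/-- Translate a quadruple so that it starts at the origin. -/
def translateQuadruple (F : Type*) [Field F] : (Fin 4 → F) ≃ F × F × F × F where
  toFun v := (v 0, v 1 - v 0, v 2 - v 0, v 3 - v 0)
  invFun | (a, x, z, y) => ![a, x + a, z + a, y + a]
  left_inv v := by ext i; fin_cases i <;> simp
  right_inv := by rintro ⟨a, x, z, y⟩; simp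

omit [NeZero k] in
-- Translation moves the first vertex to 0. Scaling by the residue x, the second vertex, preserves
-- the indicators and moves it to 1.
lemma ncard_increasing_eq_sum : ({v : Fin 4 → F | ∀ i j, i < j →
    (paleyDigraph F k).Adj (v i) (v j)}.ncard : ℂ) =
    Fintype.card F * ((∑ x : F, residueIndicator k x) *
      ∑ y : F, ∑ z : F, residueIndicator k y * residueIndicator k z * residueIndicator k (y - 1) *
        residueIndicator k (z - 1) * residueIndicator k (y - z)) := by
  classical
  have h1 : ∀ v : Fin 4 → F, (if ∀ i j, i < j → (paleyDigraph F k).Adj (v i) (v j) then (1 : ℂ)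
      else 0) = residueIndicator k (v 1 - v 0) * residueIndicator k (v 2 - v 0) *
      residueIndicator k (v 3 - v 0) * residueIndicator k (v 2 - v 1) *
      residueIndicator k (v 3 - v 1) * residueIndicator k (v 3 - v 2) := fun v ↦ by
    have h2 : (∀ i j, i < j → (paleyDigraph F k).Adj (v i) (v j)) ↔
        IsPowerResidue k (v 1 - v 0) ∧ IsPowerResidue k (v 2 - v 0) ∧
        IsPowerResidue k (v 3 - v 0) ∧ IsPowerResidue k (v 2 - v 1) ∧
        IsPowerResidue k (v 3 - v 1) ∧ IsPowerResidue k (v 3 - v 2) := by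
      simp only [Fin.forall_fin_succ, paleyDigraph, ← IsPowerResidue.eq_1]
      simp
      tauto
    simp only [h2, residueIndicator, ite_and]
    split_ifs <;> simp
  have h3 : ∀ x : F, residueIndicator k x * (∑ z : F, ∑ y : F, residueIndicator k z *
      residueIndicator k y * residueIndicator k (z - x) * residueIndicator k (y - x) *
      residueIndicator k (y - z)) = residueIndicator k x * ∑ y : F, ∑ z : F,
      residueIndicator k y * residueIndicator k z * residueIndicator k (y - 1) *
        residueIndicator k (z - 1) * residueIndicator k (y - z) := fun x ↦ by
    by_cases hx : IsPowerResidue k x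
    · have hx0 : x ≠ 0 := by obtain ⟨u, -, rfl⟩ := hx; exact u.ne_zero
      rw [Finset.sum_comm, ← Equiv.sum_comp (Equiv.mulLeft₀ x hx0)]
      refine congrArg _ (Finset.sum_congr rfl fun y _ ↦ ?_)
      rw [← Equiv.sum_comp (Equiv.mulLeft₀ x hx0)]
      refine Finset.sum_congr rfl fun z _ ↦ ?_
      have e1 : ∀ w, x * w - x = x * (w - 1) := fun w ↦ by ring
      simp only [Equiv.mulLeft₀_apply, e1, ← mul_sub, residueIndicator_mul hx]
      ring
    · simp [residueIndicator, hx]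
  rw [Set.ncard_eq_toFinset_card', Set.toFinset_ofPred, Finset.card_filter]
  push_cast
  simp only [h1]
  rw [Fintype.sum_equiv (translateQuadruple F) _ (fun p ↦ residueIndicator k p.2.1 *
    (residueIndicator k p.2.2.1 * residueIndicator k p.2.2.2 *
    residueIndicator k (p.2.2.1 - p.2.1) * residueIndicator k (p.2.2.2 - p.2.1) *
    residueIndicator k (p.2.2.2 - p.2.2.1))) fun v ↦ ?_]
  · simp only [Fintype.sum_prod_type, ← Finset.mul_sum, h3, Finset.sum_const, Finset.card_univ,
      nsmul_eq_mul, ← Finset.sum_mul]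
    ring
  · simp only [translateQuadruple, Equiv.coe_fn_mk, sub_sub_sub_cancel_right]
    ring

omit [NeZero k] in
lemma paleyDigraph_asymm (hneg : χ (-1) = -1) (hχ : orderOf χ = k) (a b : F)
    (h : (paleyDigraph F k).Adj a b) : ¬ (paleyDigraph F k).Adj b a := by
  rintro ⟨v, hv, h2⟩
  obtain ⟨u, hu, h1⟩ := h
  have h3 := (apply_eq_one_iff hχ u).mpr hu
  rw [← apply_eq_one_iff hχ, h2, ← neg_sub, ← h1, ← neg_one_mul, map_mul, h3, hneg] at hv
  norm_num at hv

end Counting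

theorem theorem2p2 (k : ℕ) [NeZero k] (hk : 2 ≤ k) (hk_even : Even k)
    (q : ℕ) (F : Type*) [Field F] [Fintype F] (hF : Fintype.card F = q)
    (hq : q ≡ k + 1 [MOD 2 * k])
    (χ : MulChar F ℂ) (hχ : orderOf χ = k) :
    (numTransitiveSubtournaments 4 (paleyDigraph F k) : ℂ) =
      (q : ℂ) * ((q : ℂ) - 1) / (k : ℂ) ^ 6 *
        (10 * jacR k χ ^ 2 + 5 * ((q : ℂ) - (k : ℂ) ^ 2 + 1) * jacR k χ
          - 10 * jacS k χ - 5 * jacSMinus k χ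
          + (q : ℂ) ^ 2 - 10 * ((k : ℂ) - 1) ^ 2 * (q : ℂ)
          + 5 * (k : ℂ) ^ 2 * ((k : ℂ) - 1) + 1
          + (q : ℂ) ^ 2 * ∑ t ∈ nondegenerate k, hypVec χ t 1) := by
  subst hF
  have hneg := apply_neg_one hk_even (NeZero.pos k) hq hχ
  have hS := gaussSystem hχ hneg
  have hk0 : (k : ℂ) ≠ 0 := Nat.cast_ne_zero.mpr (NeZero.ne k)
  have h1 := sum_pentagonSum (k := k) hχ hneg
  rw [← sq_mul_sum_hypVec hχ hneg, sum_onEdges_degenerateValue,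
    sum_degenerateTerm hS (sum_charSign hk hχ hneg), ← jacR_eq_tripleSum hχ hneg,
    ← jacS_eq hχ hneg, ← jacSMinus_eq hχ hneg, sum_pentagonSum_eq hk hχ] at h1
  -- Five factors of k come from expanding the five indicators, the sixth from the number (q-1)/k of
  -- residues.
  rw [numTransitiveSubtournaments_eq 4 (paleyDigraph_asymm hneg hχ), ncard_increasing_eq_sum,
    div_mul_eq_mul_div, eq_div_iff (pow_ne_zero 6 hk0), ← sum_residueIndicator hk hχ]
  linear_combination (Fintype.card F : ℂ) * (k * ∑ x : F, residueIndicator k x) * h1
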